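/- Graphs are finite and may have loops and multiple edges; a loop contributes $2$ to the degree of its vertex. A circuit is a closed trail with at least one edge, that is, a walk which begins and ends at the same vertex and has no repeated edges (it may visit vertices several times). A circuit-decomposition of a graph is a collection of circuits such that each edge of the graph is used by exactly one circuit in the collection; its size is the number of circuits in it. Let $\ell$ be a positive integer and let $G$ be a connected $2\ell$-regular graph with an odd number of vertices. Then there exist a vertex $b$ of $G$ and a circuit-decomposition of $G$ of size $\ell$ in which every circuit has an odd number of edges and begins and ends at $b$. -/

import Mathlib

open scoped Graph

namespace Graph

/-- The degree of a vertex in a multigraph: each incident non-loop edge counts once and each loop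
counts twice. (Every graph considered below is finite, so `Set.ncard` is the true cardinality.) -/
noncomputable def deg {α β : Type*} (G : Graph α β) (x : α) : ℕ :=
  {e | G.IsNonloopAt e x}.ncard + 2 * {e | G.IsLoopAt e x}.ncard

/-- A multigraph is `d`-regular if each of its vertices has degree `d`. -/
def IsRegular {α β : Type*} (G : Graph α β) (d : ℕ) : Prop :=
  ∀ x ∈ V(G), G.deg x = d

/-- `G.IsWalk x es y`: the edges in the list `es`, in this order, can be traversed as a walk of `G`
that begins at `x` and ends at `y`. -/
inductive IsWalk {α β : Type*} (G : Graph α β) : α → List β → α → Prop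
  | nil {x : α} (hx : x ∈ V(G)) : IsWalk G x [] x
  | cons {x y z : α} {e : β} {es : List β} (h : G.IsLink e x y) (w : IsWalk G y es z) :
      IsWalk G x (e :: es) z

/-- A multigraph is connected if it has a vertex and any two vertices are joined by a walk. -/
def IsConnected {α β : Type*} (G : Graph α β) : Prop :=
  V(G).Nonempty ∧ ∀ x ∈ V(G), ∀ y ∈ V(G), ∃ es : List β, G.IsWalk x es y

/-- A trail from `x` to `y`: a walk with at least one edge and with no repeated edge. -/
structure IsTrail {α β : Type*} (G : Graph α β) (x : α) (es : List β) (y : α) : Prop where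
  isWalk : G.IsWalk x es y
  ne_nil : es ≠ []
  nodup : es.Nodup

/-- A circuit that begins and ends at `b`: a closed trail from `b` to `b`. Vertices may be visited
several times. -/
def IsCircuitAt {α β : Type*} (G : Graph α β) (b : α) (es : List β) : Prop :=
  G.IsTrail b es b

/-- A circuit: a trail that begins and ends at the same vertex. -/
def IsCircuit {α β : Type*} (G : Graph α β) (es : List β) : Prop :=
  ∃ b, G.IsCircuitAt b es

/-- A circuit-decomposition of size `k`: a collection of `k` circuits such that each edge of the
graph is used by exactly one of them. -/
structure IsCircuitDecomposition {α β : Type*} (G : Graph α β) {k : ℕ} (C : Fin k → List β) :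
    Prop where
  isCircuit : ∀ i, G.IsCircuit (C i)
  existsUnique_mem : ∀ e ∈ E(G), ∃! i, e ∈ C i

end Graph

/-!
An odd closed walk through `b` can be coloured alternately so that its first and last edge get the
same colour. Hence a decomposition of a connected `2ℓ`-regular graph into `ℓ` odd circuits through
`b` amounts to a 2-colouring of the edges in which all edges at `b` have the same colour and every
other vertex has `ℓ` half-edges of each colour: given the colouring, pairing half-edges of different
colours at each vertex other than `b` gives `ℓ` odd circuits through `b` and some even closed walks,
and by connectedness the latter can be inserted into the former. So one wants a vertex `b` such that
the rest of the graph has a factor in which every degree is `ℓ`. Not every vertex will do, and a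
suitable one is found by induction on the number of vertices.

Let `H` be a proper subset of the vertices, of odd size, with an edge cut as small as possible; it
has size at most `2ℓ`, because single vertices are candidates. The complement `Y` of `H` induces a
graph with a factor in which every degree is `ℓ` (`HalfEdge.exists_factor`). This follows from
Tutte's theorem by way of a gadget, and the inequality that excludes a barrier
(`HalfEdge.barrier_le`) uses only parity and the minimality of the cut. Colouring the factor against
all other edges and joining half-edges of different colours at `Y` (`HalfEdge.exists_join`) turns
the graph into walks of odd length between vertices of `H`, together with even closed walks. With
these odd walks as edges, `H` becomes a `2ℓ`-regular graph of odd order, which is connected, again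
because the cut is minimum. Induction gives odd circuits in it, and substituting the odd walks for
its edges preserves the parities (`HalfEdge.Walk.subst`). The induction ends at a single vertex with
`ℓ` loops.

Multigraphs are handled as functions `p : β × Bool → α` that send each of the two halves of an edge
to its vertex, so that degrees count half-edges and loops need no special treatment.
-/

open scoped Graph

namespace HalfEdge

open Finset
open scoped Classical

/-! ### Half-edges and the barrier inequality -/

section HalfEdges

variable {α β ι : Type*}

/-- The other half of the edge that contains the half-edge `h`. -/
def flip (h : β × Bool) : β × Bool := (h.1, !h.2)

@[simp] lemma flip_fst (h : β × Bool) : (flip h).1 = h.1 := rfl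

@[simp] lemma flip_flip (h : β × Bool) : flip (flip h) = h := by simp [flip]

lemma flip_ne (h : β × Bool) : flip h ≠ h := by
  intro h'
  have := congrArg Prod.snd h'
  simp [flip] at this

/-- A set that contains both or neither of the halves of each edge has even size. -/
lemma even_card_of_flip (s : Finset (β × Bool)) (hs : ∀ h ∈ s, flip h ∈ s) : Even #s := by
  have : (∑ _x ∈ s, (1 : ZMod 2)) = 0 :=
    Finset.sum_involution (fun h _ => flip h) (fun _ _ => by decide) (fun h _ _ => flip_ne h)
      hs (fun h _ => flip_flip h)
  rw [sum_const, nsmul_one] at this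
  exact (ZMod.natCast_eq_zero_iff_even).1 this

variable [Fintype β]

/-- The degree of `v`: the number of half-edges at `v`. -/
noncomputable def degree (p : β × Bool → α) (v : α) : ℕ := #{h | p h = v}

/-- The half-edges at `A` whose other half is at `B`. An edge inside `A ∩ B` contributes both of
its halves, so that `#(between p A A)` is twice the number of edges inside `A`. -/
noncomputable def between (p : β × Bool → α) (A B : Set α) : Finset (β × Bool) :=
  {h | p h ∈ A ∧ p (flip h) ∈ B}

/-- The number of half-edges at `A` whose other half is at `B`. -/
noncomputable def nb (p : β × Bool → α) (A B : Set α) : ℕ := #(between p A B)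

/-- The size of the edge cut around `A`. -/
noncomputable def cut (p : β × Bool → α) (A : Set α) : ℕ := nb p A Aᶜ

variable (p : β × Bool → α)

lemma mem_between {A B : Set α} {h : β × Bool} :
    h ∈ between p A B ↔ p h ∈ A ∧ p (flip h) ∈ B := by simp [between]

lemma nb_comm (A B : Set α) : nb p A B = nb p B A := by
  unfold nb
  refine card_bij (fun h _ => flip h) ?_ ?_ ?_
  · intro h; simp [mem_between]; tauto
  · intro a _ b _ hab
    simpa using congrArg flip hab
  · intro h hh
    refine ⟨flip h, ?_, by simp⟩
    simp only [mem_between] at hh ⊢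
    simpa using hh.symm

lemma nb_union_left {A B : Set α} (hAB : Disjoint A B) (Z : Set α) :
    nb p (A ∪ B) Z = nb p A Z + nb p B Z := by
  unfold nb
  rw [← card_union_of_disjoint]
  · congr 1; ext h; simp [mem_between]; tauto
  · rw [Finset.disjoint_left]
    intro h h1 h2
    simp only [mem_between] at h1 h2
    exact Set.disjoint_left.1 hAB h1.1 h2.1

lemma nb_union_right {A B : Set α} (hAB : Disjoint A B) (Z : Set α) :
    nb p Z (A ∪ B) = nb p Z A + nb p Z B := by
  rw [nb_comm, nb_union_left p hAB, nb_comm p A, nb_comm p B]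

lemma nb_univ (A : Finset α) : nb p A Set.univ = ∑ v ∈ A, degree p v := by
  unfold nb degree
  rw [← card_biUnion]
  · congr 1; ext h; simp [mem_between]
  · intro x _ y _ hxy
    rw [Function.onFun, Finset.disjoint_left]
    intro h; simp; rintro rfl; exact hxy

lemma nb_eq_sum_filter [Fintype ι] (A : Finset α) (k : α → ι) (Z : Set α) :
    nb p A Z = ∑ i, nb p (A.filter (k · = i)) Z := by
  unfold nb
  rw [← card_biUnion]
  · congr 1; ext h; simp [mem_between]
  · intro x _ y _ hxy
    rw [Function.onFun, Finset.disjoint_left]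
    intro h
    simp only [mem_between, coe_filter, Set.mem_ofPred_eq]
    rintro ⟨⟨_, rfl⟩, _⟩ ⟨⟨_, h2⟩, _⟩; exact hxy h2

lemma even_nb_self (A : Set α) : Even (nb p A A) := by
  apply even_card_of_flip
  intro h; simp [mem_between]; tauto

lemma nb_self_add_cut (A : Set α) : nb p A A + cut p A = nb p A Set.univ := by
  unfold cut
  rw [← nb_union_right p disjoint_compl_right, Set.union_compl_self]

lemma even_cut {ℓ : ℕ} {A : Finset α} (hreg : ∀ v ∈ A, degree p v = 2 * ℓ) :
    Even (cut p A) := by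
  have h1 := nb_self_add_cut p A
  have h2 := even_nb_self p A
  rw [nb_univ, sum_congr rfl hreg, sum_const, smul_eq_mul] at h1
  have : Even (nb p (A : Set α) A + cut p A) := by rw [h1]; exact ⟨#A * ℓ, by ring⟩
  exact (Nat.even_add.1 this).1 h2

/-- The inequality behind Tutte's condition. `S` and `T` are the two parts of a potential barrier
inside `Y`, and the fibres of `k` on the rest of `Y` are unions of components. -/
lemma barrier_le [Fintype ι] {ℓ : ℕ} {Y S T : Finset α} (hS : S ⊆ Y) (hT : T ⊆ Y)
    (hST : Disjoint S T) (k : α → ι)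
    (hreg : ∀ y ∈ Y, degree p y = 2 * ℓ) (hY : Even #Y) (hcutY : cut p Y ≤ 2 * ℓ)
    (hpos : ∀ K ⊆ Y, K.Nonempty → 0 < cut p K)
    (hmin : ∀ K ⊆ Y, Odd #K → cut p Y ≤ cut p K)
    (hk : ∀ h, p h ∈ Y \ (S ∪ T) → p (flip h) ∈ Y \ (S ∪ T) → k (p h) = k (p (flip h))) :
    #{i | Odd (ℓ * #((Y \ (S ∪ T)).filter (k · = i)) +
      nb p ((Y \ (S ∪ T)).filter (k · = i)) T)} + nb p T S + nb p T (Y : Set α)ᶜ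
      ≤ ℓ * #S + ℓ * #T := by
  set C := Y \ (S ∪ T) with hC
  set K : ι → Finset α := fun i => C.filter (k · = i) with hK
  set Q : Finset ι := {i | Odd (ℓ * #(K i) + nb p (K i) T)} with hQ
  have hCY : C ⊆ Y := sdiff_subset
  have hKC : ∀ i, K i ⊆ C := fun i => filter_subset _ _
  have hKY : ∀ i, K i ⊆ Y := fun i => (hKC i).trans hCY
  have hST' : Disjoint (S : Set α) T := by exact_mod_cast hST
  have hSTC : Disjoint ((S : Set α) ∪ T) C := by
    rw [Set.disjoint_left]; intro x; simp [hC]; tauto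
  have hYu : (Y : Set α) = (S : Set α) ∪ (T : Set α) ∪ (C : Set α) := by
    ext x; simp [hC]
    rintro (h | h)
    exacts [hS h, hT h]
  have split (A : Set α) : nb p A Set.univ =
      nb p A S + nb p A T + nb p A C + nb p A (Y : Set α)ᶜ := by
    rw [← nb_union_right p hST', ← nb_union_right p hSTC, ← hYu,
      ← nb_union_right p disjoint_compl_right, Set.union_compl_self]
  have dsum (A : Finset α) (hA : A ⊆ Y) : nb p A Set.univ = 2 * ℓ * #A := by
    rw [nb_univ, sum_congr rfl fun v hv => hreg v (hA hv), sum_const, smul_eq_mul, mul_comm]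
  have fT := split T
  have fS := split S
  rw [dsum T hT] at fT
  rw [dsum S hS] at fS
  -- edges inside `C` stay inside one fibre
  have hKK (i : ι) : nb p (K i) C = nb p (K i) (K i) := by
    unfold nb; congr 1; ext h
    simp only [mem_between, hK, coe_filter, Set.mem_ofPred_eq, mem_coe]
    constructor
    · rintro ⟨⟨h1, rfl⟩, h2⟩
      exact ⟨⟨h1, rfl⟩, h2, (hk h h1 h2).symm⟩
    · rintro ⟨h1, h2, _⟩; exact ⟨h1, h2⟩
  have fK (i : ι) : cut p (K i) =
      nb p (K i) S + nb p (K i) T + nb p (K i) (Y : Set α)ᶜ := by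
    have h1 := nb_self_add_cut p (K i)
    have h2 := split (K i)
    rw [hKK] at h2
    omega
  have evK (i : ι) : Even (cut p (K i)) :=
    even_cut p fun v hv => hreg v (hKY i hv)
  have sumS := nb_eq_sum_filter p C k S
  have sumT := nb_eq_sum_filter p C k T
  have sumY := nb_eq_sum_filter p C k (Y : Set α)ᶜ
  have cS := nb_comm p S C
  have cT := nb_comm p T C
  have cST := nb_comm p S T
  have cutYeq : cut p Y = nb p S (Y : Set α)ᶜ + nb p T (Y : Set α)ᶜ +
      nb p C (Y : Set α)ᶜ := by
    unfold cut
    conv_lhs => rw [hYu, nb_union_left p hSTC, nb_union_left p hST', ← hYu]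
  have cardY : #S + #T + #C = #Y := by
    rw [← card_union_of_disjoint hST, hC, add_comm,
      card_sdiff_add_card_eq_card (union_subset hS hT)]
  have cardC : #C = ∑ i, #(K i) := card_eq_sum_card_fiberwise (fun x _ => mem_univ (k x))
  have evS := even_nb_self p (S : Set α)
  have evT := even_nb_self p (T : Set α)
  by_cases hex : ∃ i, Odd #(K i)
  · obtain ⟨i₀, hi₀⟩ := hex
    have h0 := hmin _ (hKY i₀) hi₀
    -- every odd fibre has a cut of size at least two, and one of them has a cut as large as `Y`
    have hQcut : ∀ i ∈ Q.erase i₀, 2 ≤ cut p (K i) := by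
      intro i hi
      have hiQ : Odd (ℓ * #(K i) + nb p (K i) T) := by simpa [hQ] using mem_of_mem_erase hi
      have hne : (K i).Nonempty := by
        by_contra hne
        rw [not_nonempty_iff_eq_empty] at hne
        rw [hne] at hiQ
        simp [nb, between] at hiQ
      have h1 := hpos _ (hKY i) hne
      obtain ⟨r, hr⟩ := evK i
      omega
    have hsum : 2 * #(Q.erase i₀) + cut p (K i₀) ≤ ∑ i, cut p (K i) := by
      rw [← Finset.sum_erase_add _ _ (mem_univ i₀)]
      gcongr
      calc 2 * #(Q.erase i₀) = ∑ i ∈ Q.erase i₀, 2 := by simp [mul_comm]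
        _ ≤ ∑ i ∈ Q.erase i₀, cut p (K i) := sum_le_sum hQcut
        _ ≤ _ := sum_le_sum_of_subset (erase_subset_erase _ (subset_univ _))
    have hQe : #Q ≤ #(Q.erase i₀) + 1 := by
      have := pred_card_le_card_erase (s := Q) (a := i₀); omega
    have hcs : ∑ i, cut p (K i) = nb p C S + nb p C T + nb p C (Y : Set α)ᶜ := by
      rw [sumS, sumT, sumY, ← sum_add_distrib, ← sum_add_distrib]
      exact sum_congr rfl fun i _ => fK i
    -- both sides have the same parity, so a deficit of one is impossible
    have par : (#Q : ZMod 2) = ℓ * #S + ℓ * #T - nb p T S - nb p T (Y : Set α)ᶜ := by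
      have h1 : (#Q : ZMod 2) = ∑ i, ((ℓ * #(K i) + nb p (K i) T : ℕ) : ZMod 2) := by
        rw [hQ, card_filter, Nat.cast_sum]
        refine sum_congr rfl fun i _ => ?_
        split_ifs with ho
        · rw [(ZMod.natCast_eq_one_iff_odd).2 ho, Nat.cast_one]
        · rw [(ZMod.natCast_eq_zero_iff_even).2 (Nat.not_odd_iff_even.1 ho), Nat.cast_zero]
      have h2 : (#S + #T + #C : ZMod 2) = 0 := by
        have := (ZMod.natCast_eq_zero_iff_even).2 hY
        rw [← cardY] at this; exact_mod_cast this
      have h3 : (2 : ZMod 2) = 0 := rfl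
      have h4 := congrArg (Nat.cast : ℕ → ZMod 2) fT
      have h5 := (ZMod.natCast_eq_zero_iff_even).2 evT
      push_cast at h4
      rw [h1, ← Nat.cast_sum, sum_add_distrib, ← mul_sum, ← cardC, ← sumT, Nat.cast_add,
        Nat.cast_mul, ← cT]
      linear_combination (ℓ : ZMod 2) * h2 - h4 - h5 + (ℓ * #T - ℓ * #S - ℓ * #T) * h3
    have hle : #Q + nb p T S + nb p T (Y : Set α)ᶜ ≤ ℓ * #S + ℓ * #T + 1 := by
      nlinarith
    have par' : ((#Q + nb p T S + nb p T (Y : Set α)ᶜ : ℕ) : ZMod 2) =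
        ((ℓ * #S + ℓ * #T : ℕ) : ZMod 2) := by
      push_cast; rw [par]; ring
    rw [ZMod.natCast_eq_natCast_iff, Nat.ModEq] at par'
    omega
  · simp only [not_exists, Nat.not_odd_iff_even] at hex
    have hodd : ∀ i ∈ Q, Odd (nb p (K i) T) := by
      intro i hi
      have hiQ : Odd (ℓ * #(K i) + nb p (K i) T) := by simpa [hQ] using hi
      rw [Nat.odd_add] at hiQ
      by_contra hc
      exact (Nat.not_odd_iff_even.2 ((hex i).mul_left ℓ)) (hiQ.2 (Nat.not_odd_iff_even.1 hc))
    rcases le_or_gt #T #S with hle | hlt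
    · have hq : #Q ≤ nb p C T := by
        rw [sumT]
        calc #Q = ∑ i ∈ Q, 1 := by simp
          _ ≤ ∑ i ∈ Q, nb p (K i) T := sum_le_sum fun i hi => (hodd i hi).pos
          _ ≤ _ := sum_le_sum_of_subset (subset_univ _)
      have := Nat.mul_le_mul_left ℓ hle
      nlinarith
    · have hq : #Q ≤ nb p C S + nb p C (Y : Set α)ᶜ := by
        rw [sumS, sumY, ← sum_add_distrib]
        calc #Q = ∑ i ∈ Q, 1 := by simp
          _ ≤ ∑ i ∈ Q, (nb p (K i) S + nb p (K i) (Y : Set α)ᶜ) := sum_le_sum fun i hi => by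
            have h1 := hodd i hi
            have h2 := evK i
            rw [fK i] at h2
            by_contra hc
            have h3 : nb p (K i) S = 0 := by omega
            have h4 : nb p (K i) (Y : Set α)ᶜ = 0 := by omega
            rw [h3, h4] at h2
            simp only [zero_add, add_zero] at h2
            exact (Nat.not_even_iff_odd.2 h1) h2
          _ ≤ _ := sum_le_sum_of_subset (subset_univ _)
      have hC2 : Even #C := by
        rw [cardC]; exact even_sum _ fun i _ => hex i
      have hST2 : #S + 2 ≤ #T := by
        obtain ⟨a, ha⟩ := hC2
        obtain ⟨b, hb⟩ := hY
        omega
      have := Nat.mul_le_mul_left ℓ hST2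
      nlinarith

end HalfEdges

/-! ### Barriers in graphs without a perfect matching -/

section Tutte

variable {W ι : Type*} [Fintype W] [Fintype ι]

/-- A labelled barrier of `Γ`: the vertices labelled `none` form the deleted set, and no edge joins
two remaining vertices with different labels. There are more labels that occur an odd number of
times than deleted vertices. The labels need not separate the components of what remains, only
distinguish enough of them, and this makes such barriers easy to modify. -/
def IsBarrier (Γ : SimpleGraph W) (κ : W → Option ι) : Prop :=
  (∀ v w i j, Γ.Adj v w → κ v = some i → κ w = some j → i = j) ∧
    #{w | κ w = none} < #{i | Odd #{w | κ w = some i}}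

/-- A deleted vertex whose remaining neighbours carry at most two labels can be restored: merging
these two labels at the restored vertex destroys at most one odd label. -/
lemma IsBarrier.restore {Γ : SimpleGraph W} {κ : W → Option ι} (hκ : IsBarrier Γ κ) {u : W}
    (hu : κ u = none) (a b : ι)
    (hab : ∀ w i, Γ.Adj u w → κ w = some i → i = a ∨ i = b) :
    ∃ κ' : W → Option ι, IsBarrier Γ κ' ∧ #{w | κ' w = none} < #{w | κ w = none} := by
  let g : ι → ι := fun i => if i = b then a else i
  let κ' : W → Option ι := fun w => if w = u then some a else (κ w).map g
  have hga : g a = a := by simp only [g]; split_ifs <;> rfl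
  have hgb : g b = a := by simp [g]
  have hnone : ({w | κ' w = none} : Finset W) = ({w | κ w = none} : Finset W).erase u := by
    ext w
    by_cases hw : w = u <;> simp [κ', hw]
  have hmem : u ∈ ({w | κ w = none} : Finset W) := by simpa using hu
  have hcard : #{w | κ' w = none} + 1 = #{w | κ w = none} := by
    rw [hnone, card_erase_add_one hmem]
  refine ⟨κ', ⟨?_, ?_⟩, by omega⟩
  · have key : ∀ w j, Γ.Adj u w → κ' w = some j → j = a := by
      intro w j hw hj
      have hwu : w ≠ u := hw.ne'
      simp only [κ', hwu, if_false, Option.map_eq_some_iff] at hj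
      obtain ⟨i, hi, rfl⟩ := hj
      rcases hab w i hw hi with rfl | rfl
      exacts [hga, hgb]
    intro v w i j hvw hi hj
    by_cases hv : v = u
    · subst hv
      have : a = i := by simpa [κ'] using hi
      rw [← this, key w j hvw hj]
    by_cases hw : w = u
    · subst hw
      have : a = j := by simpa [κ'] using hj
      rw [← this, key v i hvw.symm hi]
    simp only [κ', hv, hw, if_false, Option.map_eq_some_iff] at hi hj
    obtain ⟨i', hi', rfl⟩ := hi
    obtain ⟨j', hj', rfl⟩ := hj
    rw [hκ.1 v w i' j' hvw hi' hj']
  · have hlt := hκ.2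
    -- the fibres of labels other than `a` and `b` are unchanged
    have hother : ∀ i, i ≠ a → i ≠ b →
        ({w | κ' w = some i} : Finset W) = ({w | κ w = some i} : Finset W) := by
      intro i hia hib
      ext w
      by_cases hw : w = u
      · subst hw; simp [κ', hu, hia.symm]
      · simp only [κ', hw, if_false, mem_filter, mem_univ, true_and, Option.map_eq_some_iff, g]
        constructor
        · rintro ⟨j, hj, rfl⟩
          split_ifs at hia ⊢ with h
          · exact absurd rfl hia
          · exact hj
        · intro h; exact ⟨i, h, by simp [hib]⟩
    set O : Finset ι := {i | Odd #{w | κ w = some i}} with hO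
    set O' : Finset ι := {i | Odd #{w | κ' w = some i}} with hO'
    have hsub : (O.erase a).erase b ⊆ (O'.erase a).erase b := by
      intro i
      simp only [mem_erase, hO, hO', mem_filter, mem_univ, true_and]
      rintro ⟨hib, hia, ho⟩
      refine ⟨hib, hia, ?_⟩
      rwa [hother i hia hib]
    have hsub' := card_le_card hsub
    -- the new fibre of `a` consists of the restored vertex and the old fibres of `a` and `b`
    have hfa : #{w | κ' w = some a} = #{w | κ w = some a ∨ κ w = some b} + 1 := by
      have : ({w | κ' w = some a} : Finset W) =
          insert u ({w | κ w = some a ∨ κ w = some b} : Finset W) := by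
        ext w
        by_cases hw : w = u
        · subst hw; simp [κ']
        · simp only [κ', hw, if_false, mem_filter, mem_univ, true_and, Option.map_eq_some_iff, g,
            mem_insert, false_or]
          constructor
          · rintro ⟨j, hj, hja⟩
            split_ifs at hja with h
            · right; rw [hj, h]
            · left; rw [hj, hja]
          · rintro (h | h)
            · exact ⟨a, h, hga⟩
            · exact ⟨b, h, hgb⟩
      rw [this, card_insert_of_notMem (by simp [hu])]
    have hmain : #O ≤ #O' + 1 := by
      by_cases habeq : a = b
      · subst habeq
        have h1 := pred_card_le_card_erase (s := O) (a := a)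
        have h2 := card_le_card (erase_subset a O')
        simp only [erase_idem] at hsub'
        omega
      · have h3 : #{w | κ w = some a ∨ κ w = some b} =
            #{w | κ w = some a} + #{w | κ w = some b} := by
          rw [filter_or, card_union_of_disjoint]
          rw [Finset.disjoint_left]
          intro w; simp only [mem_filter, mem_univ, true_and]
          intro h h'; rw [h] at h'; exact habeq (Option.some.inj h')
        rw [h3] at hfa
        by_cases hboth : a ∈ O ∧ b ∈ O
        · have ha' : a ∈ O' := by
            simp only [hO, hO', mem_filter, mem_univ, true_and] at hboth ⊢
            rw [hfa]
            exact (hboth.1.add_odd hboth.2).add_one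
          have h1 := pred_card_le_card_erase (s := O) (a := a)
          have h2 := pred_card_le_card_erase (s := O.erase a) (a := b)
          have h4 := card_erase_add_one ha'
          have h5 := card_le_card (erase_subset b (O'.erase a))
          omega
        · have h6 : #O ≤ #((O.erase a).erase b) + 1 := by
            rw [not_and_or] at hboth
            rcases hboth with h | h
            · rw [erase_eq_of_notMem h]
              have := pred_card_le_card_erase (s := O) (a := b); omega
            · rw [erase_right_comm, erase_eq_of_notMem h]
              have := pred_card_le_card_erase (s := O) (a := a); omega
          have h5 := card_le_card (erase_subset b (O'.erase a))
          have h7 := card_le_card (erase_subset a O')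
          omega
    omega

/-- A finite graph without a perfect matching has a barrier, by Tutte's theorem. Choosing one with
the fewest deleted vertices, every deleted vertex has remaining neighbours with at least three
different labels. -/
lemma exists_minimal_barrier.{u} {W : Type u} [Fintype W] (Γ : SimpleGraph W)
    (hΓ : ¬ ∃ M : Γ.Subgraph, M.IsPerfectMatching) :
    ∃ (ι : Type u) (_ : Fintype ι) (κ : W → Option ι), IsBarrier Γ κ ∧
      ∀ u, κ u = none → ∀ a b, ∃ w i, Γ.Adj u w ∧ κ w = some i ∧ i ≠ a ∧ i ≠ b := by
  rw [SimpleGraph.tutte] at hΓ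
  push Not at hΓ
  obtain ⟨U, hU⟩ := hΓ
  set Δ := ((⊤ : Γ.Subgraph).deleteVerts U) with hΔ
  have hV : ∀ w, w ∈ Δ.verts ↔ w ∉ U := by intro w; simp [hΔ]
  let _ : Fintype Δ.coe.ConnectedComponent := Fintype.ofFinite _
  let κ : W → Option Δ.coe.ConnectedComponent := fun w =>
    if h : w ∈ Δ.verts then some (Δ.coe.connectedComponentMk ⟨w, h⟩) else none
  have hκ : IsBarrier Γ κ := by
    constructor
    · intro v w i j hvw hi hj
      simp only [κ] at hi hj
      split_ifs at hi hj with h1 h2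
      simp only [Option.some.injEq] at hi hj
      rw [← hi, ← hj]
      apply SimpleGraph.ConnectedComponent.sound
      apply SimpleGraph.Adj.reachable
      have h1' := (hV v).1 h1
      have h2' := (hV w).1 h2
      simp only [SimpleGraph.Subgraph.coe_adj, hΔ, SimpleGraph.Subgraph.deleteVerts_adj,
        SimpleGraph.Subgraph.verts_top, SimpleGraph.Subgraph.top_adj]
      exact ⟨trivial, h1', trivial, h2', hvw⟩
    · unfold SimpleGraph.IsTutteViolator at hU
      have h1 : #{w | κ w = none} = U.ncard := by
        rw [Set.ncard_eq_toFinset_card']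
        congr 1; ext w
        simp only [κ, mem_filter, mem_univ, true_and, Set.mem_toFinset]
        split_ifs with h
        · simpa using (hV w).1 h
        · simpa using (not_iff_not.2 (hV w)).1 h
      have h2 : #{i | Odd #{w | κ w = some i}} = Δ.coe.oddComponents.ncard := by
        rw [Set.ncard_eq_toFinset_card']
        congr 1; ext c
        simp only [mem_filter, mem_univ, true_and, Set.mem_toFinset, SimpleGraph.oddComponents]
        have : #{w | κ w = some c} = c.supp.ncard := by
          rw [← Set.ncard_image_of_injective _ Subtype.val_injective,
            Set.ncard_eq_toFinset_card']
          congr 1; ext w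
          simp only [κ, mem_filter, mem_univ, true_and, Set.mem_toFinset, Set.mem_image,
            SimpleGraph.ConnectedComponent.mem_supp_iff, Subtype.exists]
          constructor
          · intro h
            split_ifs at h with h'
            exact ⟨w, h', Option.some.inj h, rfl⟩
          · rintro ⟨w', h', h, rfl⟩
            simp [h', h]
        rw [this]; rfl
      rw [h1, h2]; exact hU
  let P : ℕ → Prop := fun n =>
    ∃ κ : W → Option Δ.coe.ConnectedComponent, IsBarrier Γ κ ∧ #{w | κ w = none} = n
  have hP : ∃ n, P n := ⟨_, κ, hκ, rfl⟩
  obtain ⟨κ₀, h0, h0n⟩ := Nat.find_spec hP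
  refine ⟨_, inferInstance, κ₀, h0, ?_⟩
  intro u hu a b
  by_contra hcon
  push Not at hcon
  obtain ⟨κ', h', hlt⟩ := h0.restore hu a b (by
    intro w i hw hi
    by_contra hne
    push Not at hne
    exact hne.2 (hcon w i hw hi hne.1))
  exact Nat.find_min hP (h0n ▸ hlt) ⟨κ', h', rfl⟩

end Tutte

/-! ### A factor outside a minimum odd cut -/

section Factor

variable {α β : Type*}

/-- Tutte's gadget for a factor of the graph induced on `Y` in which every degree is `ℓ`. The
vertices are the half-edges at `Y` and `ℓ` further vertices for each `y ∈ Y`. These are joined to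
the half-edges at `y`, and the two halves of an edge inside `Y` are joined to each other. -/
def gadget (p : β × Bool → α) (Y : Finset α) (ℓ : ℕ) :
    SimpleGraph ({h : β × Bool // p h ∈ Y} ⊕ (Y × Fin ℓ)) where
  Adj v w := match v, w with
    | .inl h, .inl h' => h'.1 = flip h.1
    | .inl h, .inr x => p h.1 = x.1
    | .inr x, .inl h => p h.1 = x.1
    | .inr _, .inr _ => False
  symm := ⟨by
    rintro (h | x) (h' | x') hh
    · change h.1 = flip h'.1
      change h'.1 = flip h.1 at hh
      rw [hh, flip_flip]
    · exact hh
    · exact hh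
    · exact hh⟩
  loopless := ⟨by
    rintro (h | x) hh
    · exact flip_ne h.1 (Eq.symm hh)
    · exact hh⟩

variable [Fintype β]

/-- The edges whose two halves are matched to each other in a perfect matching of the gadget form a
factor of the graph induced on `Y`. -/
lemma factor_of_isPerfectMatching {p : β × Bool → α} {Y : Finset α} {ℓ : ℕ}
    (hreg : ∀ y ∈ Y, degree p y = 2 * ℓ)
    (hM : ∃ M : (gadget p Y ℓ).Subgraph, M.IsPerfectMatching) :
    ∃ c : β → Bool, (∀ h : β × Bool, c h.1 = true → p h ∈ Y) ∧
      ∀ y ∈ Y, #{h | p h = y ∧ c h.1 = true} = ℓ := by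
  obtain ⟨M, hM⟩ := hM
  rw [SimpleGraph.Subgraph.isPerfectMatching_iff] at hM
  let c : β → Bool := fun e =>
    decide (∃ h h' : {h : β × Bool // p h ∈ Y}, h.1.1 = e ∧ M.Adj (.inl h) (.inl h'))
  have hadj {h h' : {h : β × Bool // p h ∈ Y}} (hh : M.Adj (.inl h) (.inl h')) :
      h'.1 = flip h.1 := hh.adj_sub
  have hadj' {h : {h : β × Bool // p h ∈ Y}} {x : Y × Fin ℓ} (hh : M.Adj (.inr x) (.inl h)) :
      p h.1 = x.1 := hh.adj_sub
  have hcases {h h₀ : β × Bool} (he : h₀.1 = h.1) : h = h₀ ∨ h = flip h₀ := by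
    obtain ⟨e, i⟩ := h
    obtain ⟨e₀, i₀⟩ := h₀
    cases i <;> cases i₀ <;> simp_all [flip]
  have hc (h : β × Bool) : c h.1 = true ↔
      ∃ (hY : p h ∈ Y) (hY' : p (flip h) ∈ Y), M.Adj (.inl ⟨h, hY⟩) (.inl ⟨flip h, hY'⟩) := by
    simp only [c, decide_eq_true_eq]
    constructor
    · rintro ⟨⟨h₀, hh₀⟩, ⟨h', hh'⟩, he, hM'⟩
      obtain rfl := hadj hM'
      rcases hcases he with rfl | rfl
      · exact ⟨hh₀, hh', hM'⟩
      · refine ⟨hh', by simpa using hh₀, ?_⟩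
        simpa using hM'.symm
    · rintro ⟨hY, hY', hM'⟩
      exact ⟨_, _, rfl, hM'⟩
  refine ⟨c, fun h hh => ((hc h).1 hh).1, fun y hy => ?_⟩
  have hfalse : #{h | p h = y ∧ ¬ c h.1 = true} = ℓ := by
    have hmate (k : Fin ℓ) :
        ∃ h : {h : β × Bool // p h ∈ Y}, M.Adj (.inr (⟨y, hy⟩, k)) (.inl h) := by
      obtain ⟨w, hw, -⟩ := hM (.inr (⟨y, hy⟩, k))
      rcases w with h | x
      · exact ⟨h, hw⟩
      · exact absurd hw.adj_sub (fun h => h)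
    choose m hm using hmate
    conv_rhs => rw [← Fintype.card_fin ℓ, ← card_univ]
    symm
    refine card_bij (fun k _ => (m k).1) ?_ ?_ ?_
    · intro k _
      simp only [mem_filter, mem_univ, true_and]
      refine ⟨hadj' (hm k), fun hcon => ?_⟩
      obtain ⟨hY, hY', hM'⟩ := (hc _).1 hcon
      have := (hM (.inl (m k))).unique (hm k).symm hM'
      cases this
    · intro k _ k' _ hkk
      have h1 := (hm k).symm
      rw [Subtype.ext hkk] at h1
      have := (hM (.inl (m k'))).unique h1 (hm k').symm
      simpa using this
    · intro h hh
      simp only [mem_filter, mem_univ, true_and] at hh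
      obtain ⟨rfl, hcf⟩ := hh
      obtain ⟨w, hw, -⟩ := hM (.inl ⟨h, hy⟩)
      rcases w with h' | ⟨y', k⟩
      · exact absurd (by simp only [c, decide_eq_true_eq]; exact ⟨_, _, rfl, hw⟩) hcf
      · have hy' : y' = ⟨p h, hy⟩ := Subtype.ext (hadj' hw.symm).symm
        subst hy'
        refine ⟨k, mem_univ _, ?_⟩
        have := (hM (.inr (⟨p h, hy⟩, k))).unique (hm k) hw.symm
        exact congrArg Subtype.val (Sum.inl.inj this)
  have hsum := card_filter_add_card_filter_not (s := ({h | p h = y} : Finset (β × Bool)))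
    (fun h => c h.1 = true)
  rw [filter_filter, filter_filter, hfalse] at hsum
  have := hreg y hy
  unfold degree at this
  omega

/-- A minimal barrier of the gadget, in terms of the labels `a` of the half-edges and the labels
`b` of the additional vertices. -/
lemma exists_gadget_barrier.{u, v} {α : Type u} {β : Type v} [Fintype β]
    {p : β × Bool → α} {Y : Finset α} {ℓ : ℕ} (hreg : ∀ y ∈ Y, degree p y = 2 * ℓ)
    (hno : ¬ ∃ c : β → Bool, (∀ h : β × Bool, c h.1 = true → p h ∈ Y) ∧
      ∀ y ∈ Y, #{h | p h = y ∧ c h.1 = true} = ℓ) :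
    ∃ (ι : Type (max u v)) (_ : Fintype ι) (a : β × Bool → Option ι) (b : α → Fin ℓ → Option ι),
      (∀ h i j, p h ∈ Y → p (flip h) ∈ Y → a h = some i → a (flip h) = some j → i = j) ∧
      (∀ h k i j, p h ∈ Y → a h = some i → b (p h) k = some j → i = j) ∧
      (#{h | p h ∈ Y ∧ a h = none} + #{x ∈ Y ×ˢ univ | b x.1 x.2 = none} <
        #{i | Odd (#{h | p h ∈ Y ∧ a h = some i} + #{x ∈ Y ×ˢ univ | b x.1 x.2 = some i})}) ∧
      (∀ h, p h ∈ Y → a h = none → ∀ u v, (∃ k i, b (p h) k = some i ∧ i ≠ u ∧ i ≠ v) ∨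
        (p (flip h) ∈ Y ∧ ∃ i, a (flip h) = some i ∧ i ≠ u ∧ i ≠ v)) ∧
      (∀ y ∈ Y, ∀ k, b y k = none → ∀ u v, ∃ h i, p h = y ∧ a h = some i ∧ i ≠ u ∧ i ≠ v) := by
  obtain ⟨ι, _, κ, ⟨hadj, hcount⟩, hmin⟩ := exists_minimal_barrier (gadget p Y ℓ)
    (fun h => hno (factor_of_isPerfectMatching hreg h))
  let a : β × Bool → Option ι := fun h => if hh : p h ∈ Y then κ (.inl ⟨h, hh⟩) else none
  let b : α → Fin ℓ → Option ι := fun y k => if hh : y ∈ Y then κ (.inr (⟨y, hh⟩, k)) else none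
  have ha (h) (hh : p h ∈ Y) : a h = κ (.inl ⟨h, hh⟩) := by simp [a, hh]
  have hb (y k) (hh : y ∈ Y) : b y k = κ (.inr (⟨y, hh⟩, k)) := by simp [b, hh]
  have hcard (o : Option ι) : #{w | κ w = o} =
      #{h | p h ∈ Y ∧ a h = o} + #{x ∈ Y ×ˢ univ | b x.1 x.2 = o} := by
    rw [card_filter, Fintype.sum_sum_type, ← card_filter, ← card_filter]
    congr 1
    · refine card_bij (fun h _ => h.1) ?_ ?_ ?_
      · intro h hh
        simp only [mem_filter, mem_univ, true_and] at hh ⊢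
        exact ⟨h.2, by rw [ha _ h.2]; exact hh⟩
      · intro h _ h' _ hhh; exact Subtype.ext hhh
      · intro h hh
        simp only [mem_filter, mem_univ, true_and] at hh
        exact ⟨⟨h, hh.1⟩, by simpa [ha _ hh.1] using hh.2, rfl⟩
    · refine card_bij (fun x _ => (x.1.1, x.2)) ?_ ?_ ?_
      · rintro ⟨y, k⟩ hh
        simp only [mem_filter, mem_univ, true_and] at hh
        simp only [mem_filter, mem_product, mem_univ, and_true]
        exact ⟨y.2, by rw [hb _ _ y.2]; exact hh⟩
      · rintro ⟨y, k⟩ _ ⟨y', k'⟩ _ hhh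
        simp only [Prod.mk.injEq] at hhh
        rw [Subtype.ext hhh.1, hhh.2]
      · rintro ⟨y, k⟩ hh
        simp only [mem_filter, mem_product, mem_univ, and_true] at hh
        exact ⟨(⟨y, hh.1⟩, k), by simpa [hb _ _ hh.1] using hh.2, rfl⟩
  refine ⟨ι, inferInstance, a, b, ?_, ?_, ?_, ?_, ?_⟩
  · intro h i j h1 h2 hi hj
    rw [ha _ h1] at hi
    rw [ha _ h2] at hj
    exact hadj (.inl ⟨h, h1⟩) (.inl ⟨flip h, h2⟩) i j rfl hi hj
  · intro h k i j h1 hi hj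
    rw [ha _ h1] at hi
    rw [hb _ _ h1] at hj
    exact hadj (.inl ⟨h, h1⟩) (.inr (⟨p h, h1⟩, k)) i j rfl hi hj
  · rw [← hcard]
    simp only [← hcard]
    exact hcount
  · intro h hh hn u v
    rw [ha _ hh] at hn
    obtain ⟨w, i, hw, hi, h1, h2⟩ := hmin _ hn u v
    rcases w with ⟨h', hh'⟩ | ⟨⟨y, hy⟩, k⟩
    · obtain rfl : h' = flip h := hw
      exact .inr ⟨hh', i, by rw [ha _ hh']; exact hi, h1, h2⟩
    · obtain rfl : p h = y := hw
      exact .inl ⟨k, i, by rw [hb _ _ hy]; exact hi, h1, h2⟩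
  · intro y hy k hn u v
    rw [hb _ _ hy] at hn
    obtain ⟨w, i, hw, hi, h1, h2⟩ := hmin _ hn u v
    rcases w with ⟨h', hh'⟩ | ⟨⟨y, hy⟩, k⟩
    · exact ⟨h', i, hw, by rw [ha _ hh']; exact hi, h1, h2⟩
    · exact absurd hw (fun h => h)

/-- The complement `Y` of a minimum odd cut induces a subgraph that has a factor in which every
degree is `ℓ`. -/
lemma exists_factor {p : β × Bool → α} {Y : Finset α} {ℓ : ℕ} (hℓ : 0 < ℓ)
    (hreg : ∀ y ∈ Y, degree p y = 2 * ℓ) (hY : Even #Y) (hcutY : cut p Y ≤ 2 * ℓ)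
    (hpos : ∀ K ⊆ Y, K.Nonempty → 0 < cut p K)
    (hmin : ∀ K ⊆ Y, Odd #K → cut p Y ≤ cut p K) :
    ∃ c : β → Bool, (∀ h : β × Bool, c h.1 = true → p h ∈ Y) ∧
      ∀ y ∈ Y, #{h | p h = y ∧ c h.1 = true} = ℓ := by
  by_contra hno
  obtain ⟨ι, _, a, b, hadj, hadj', hcount, hm1, hm2⟩ := exists_gadget_barrier hreg hno
  have : Nonempty ι := by
    obtain ⟨i, -⟩ := card_pos.1 (lt_of_le_of_lt (Nat.zero_le _) hcount)
    exact ⟨i⟩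
  -- by minimality, each of the two kinds of gadget vertices at `y` is deleted completely or not at
  -- all, and they are not both deleted
  have c1 : ∀ h h', p h ∈ Y → a h = none → p h' = p h → a h' = none := by
    intro h h' hh hn hhh
    by_contra hne
    obtain ⟨i, hi⟩ := Option.ne_none_iff_exists'.1 hne
    have hin : ∀ k j, b (p h) k = some j → j = i := fun k j hj =>
      (hadj' h' k i j (hhh ▸ hh) hi (hhh ▸ hj)).symm
    rcases hm1 h hh hn i ((a (flip h)).getD i) with ⟨k, j, hj, h1, -⟩ | ⟨-, j, hj, -, h2⟩
    · exact h1 (hin k j hj)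
    · rw [hj] at h2; exact h2 rfl
  have c2 : ∀ h k, p h ∈ Y → b (p h) k = none → a h ≠ none := by
    intro h k hh hb hn
    obtain ⟨h', i, hh', hi, -⟩ := hm2 _ hh k hb (Classical.arbitrary ι) (Classical.arbitrary ι)
    rw [c1 h h' hh hn hh'] at hi
    cases hi
  have c3 : ∀ y ∈ Y, ∀ k k', b y k = none → b y k' = none := by
    intro y hy k k' hb
    by_contra hne
    obtain ⟨j, hj⟩ := Option.ne_none_iff_exists'.1 hne
    obtain ⟨h', i, rfl, hi, h1, -⟩ := hm2 _ hy k hb j j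
    exact h1 (hadj' h' k' i j hy hi hj)
  let k₀ : Fin ℓ := ⟨0, hℓ⟩
  set S : Finset α := {y ∈ Y | ∃ h, p h = y ∧ a h = none} with hSdef
  set T : Finset α := {y ∈ Y | b y k₀ = none} with hTdef
  set C : Finset α := Y \ (S ∪ T) with hCdef
  have hS : S ⊆ Y := filter_subset _ _
  have hT : T ⊆ Y := filter_subset _ _
  have hCY : C ⊆ Y := sdiff_subset
  have memS (h) : p h ∈ S ↔ p h ∈ Y ∧ a h = none := by
    simp only [hSdef, mem_filter]
    constructor
    · rintro ⟨hh, h', hh', hn⟩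
      exact ⟨hh, c1 h' h (hh' ▸ hh) hn hh'.symm⟩
    · rintro ⟨hh, hn⟩; exact ⟨hh, h, rfl, hn⟩
  have memT (y) (k) : y ∈ T ↔ y ∈ Y ∧ b y k = none := by
    simp only [hTdef, mem_filter]
    exact ⟨fun h => ⟨h.1, c3 y h.1 _ _ h.2⟩, fun h => ⟨h.1, c3 y h.1 _ _ h.2⟩⟩
  have hST : Disjoint S T := by
    rw [Finset.disjoint_left]
    intro y hyS hyT
    obtain ⟨hy, h, rfl, hn⟩ := mem_filter.1 hyS
    exact c2 h k₀ hy ((memT _ k₀).1 hyT).2 hn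
  let lab : α → ι := fun y => (b y k₀).getD (Classical.arbitrary ι)
  have labC (h) (hh : p h ∈ C) : a h = some (lab (p h)) := by
    have hh' : p h ∈ Y ∧ p h ∉ S ∧ p h ∉ T := by simpa [hCdef] using hh
    have h1 : a h ≠ none := fun hn => hh'.2.1 ((memS h).2 ⟨hh'.1, hn⟩)
    have h2 : b (p h) k₀ ≠ none := fun hn => hh'.2.2 ((memT _ k₀).2 ⟨hh'.1, hn⟩)
    obtain ⟨i, hi⟩ := Option.ne_none_iff_exists'.1 h1
    obtain ⟨j, hj⟩ := Option.ne_none_iff_exists'.1 h2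
    simp only [lab, hj, Option.getD_some, hi]
    rw [hadj' h k₀ i j hh'.1 hi hj]
  have labC' (y k) (hh : y ∈ C) : b y k = some (lab y) := by
    have hh' : y ∈ Y ∧ y ∉ S ∧ y ∉ T := by simpa [hCdef] using hh
    have hd := hreg y hh'.1
    have hdp : 0 < degree p y := by omega
    obtain ⟨h, hhy⟩ := card_pos.1 hdp
    obtain rfl : p h = y := by simpa using hhy
    have h2 : b (p h) k ≠ none := fun hn => hh'.2.2 ((memT _ k).2 ⟨hh'.1, hn⟩)
    obtain ⟨j, hj⟩ := Option.ne_none_iff_exists'.1 h2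
    rw [hj, hadj' h k _ _ hh'.1 (labC h hh) hj]
  have hbar := barrier_le p hS hT hST lab hreg hY hcutY hpos hmin (by
    intro h h1 h2
    exact hadj h _ _ (hCY h1) (hCY h2) (labC h h1) (labC _ h2))
  rw [← hCdef] at hbar
  have degsum (A : Finset α) (hA : A ⊆ Y) : #{h | p h ∈ A} = 2 * ℓ * #A := by
    have h1 := nb_univ p A
    rw [sum_congr rfl fun v hv => hreg v (hA hv), sum_const, smul_eq_mul, mul_comm] at h1
    rw [← h1]; unfold nb; congr 1; ext h; simp [mem_between]
  have hnone1 : #{h | p h ∈ Y ∧ a h = none} = 2 * ℓ * #S := by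
    rw [← degsum S hS]; congr 1; ext h; simp [memS]
  have hnone2 : #{x ∈ Y ×ˢ (univ : Finset (Fin ℓ)) | b x.1 x.2 = none} = ℓ * #T := by
    have : ({x ∈ Y ×ˢ (univ : Finset (Fin ℓ)) | b x.1 x.2 = none}) = T ×ˢ univ := by
      ext ⟨y, k⟩; simp [memT y k]
    rw [this, card_product, card_univ, Fintype.card_fin, mul_comm]
  set O1 : Finset ι := (S ×ˢ (univ : Finset (Fin ℓ))).image
    fun x => (b x.1 x.2).getD (Classical.arbitrary ι) with hO1
  set O2 : Finset ι := (between p T S ∪ between p T (Y : Set α)ᶜ).image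
    fun h => (a h).getD (Classical.arbitrary ι) with hO2
  have hO1c : #O1 ≤ ℓ * #S := by
    refine card_image_le.trans ?_
    rw [card_product, card_univ, Fintype.card_fin, mul_comm]
  have hO2c : #O2 ≤ nb p T S + nb p T (Y : Set α)ᶜ := card_image_le.trans (card_union_le _ _)
  have hsub : ({i | Odd (#{h | p h ∈ Y ∧ a h = some i} +
      #{x ∈ Y ×ˢ (univ : Finset (Fin ℓ)) | b x.1 x.2 = some i})} : Finset ι) ⊆
      O1 ∪ O2 ∪ ({i | Odd (ℓ * #(C.filter (lab · = i)) +
        nb p (C.filter (lab · = i)) T)} : Finset ι) := by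
    intro i hi
    simp only [mem_filter, mem_univ, true_and] at hi
    by_cases hi1 : i ∈ O1
    · exact mem_union_left _ (mem_union_left _ hi1)
    by_cases hi2 : i ∈ O2
    · exact mem_union_left _ (mem_union_right _ hi2)
    refine mem_union_right _ ?_
    simp only [mem_filter, mem_univ, true_and]
    set K := C.filter (lab · = i) with hK
    have hKY : K ⊆ Y := (filter_subset _ _).trans hCY
    have e2 : #{x ∈ Y ×ˢ (univ : Finset (Fin ℓ)) | b x.1 x.2 = some i} = ℓ * #K := by
      have : ({x ∈ Y ×ˢ (univ : Finset (Fin ℓ)) | b x.1 x.2 = some i}) = K ×ˢ univ := by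
        ext ⟨y, k⟩
        simp only [mem_filter, mem_product, mem_univ, and_true, hK]
        constructor
        · rintro ⟨hy, hbi⟩
          have hyS : y ∉ S := fun hyS => hi1 (by
            rw [hO1, mem_image]
            exact ⟨(y, k), by simp [hyS], by simp [hbi]⟩)
          have hyT : y ∉ T := fun hyT => by
            rw [((memT y k).1 hyT).2] at hbi; cases hbi
          have hyC : y ∈ C := by simp [hCdef, hy, hyS, hyT]
          rw [labC' y k hyC] at hbi
          exact ⟨hyC, Option.some.inj hbi⟩
        · rintro ⟨hyC, rfl⟩
          exact ⟨hCY hyC, labC' y k hyC⟩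
      rw [this, card_product, card_univ, Fintype.card_fin, mul_comm]
    -- half-edges at `T` with label `i` whose other half is at `T` come in pairs
    set B : Finset (β × Bool) := {h | (p h ∈ T ∧ a h = some i) ∧ p (flip h) ∈ T} with hB
    have memTa (h) (hh : p h ∈ T) : a h ≠ none := c2 h k₀ (hT hh) ((memT _ k₀).1 hh).2
    have hBeven : Even #B := by
      apply even_card_of_flip
      intro h hh
      simp only [hB, mem_filter, mem_univ, true_and, flip_flip] at hh ⊢
      obtain ⟨⟨h1, h2⟩, h3⟩ := hh
      obtain ⟨j, hj⟩ := Option.ne_none_iff_exists'.1 (memTa _ h3)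
      refine ⟨⟨h3, ?_⟩, h1⟩
      rw [hj, hadj h i j (hT h1) (hT h3) h2 hj]
    have e1 : ({h | p h ∈ Y ∧ a h = some i} : Finset (β × Bool)) =
        ({h | p h ∈ K} : Finset (β × Bool)) ∪ (B ∪ between p T K) := by
      ext h
      simp only [mem_filter, mem_univ, true_and, mem_union, hB, mem_between, mem_coe]
      constructor
      · rintro ⟨hh, hi⟩
        have hhS : p h ∉ S := fun hc => by rw [((memS h).1 hc).2] at hi; cases hi
        by_cases hhT : p h ∈ T
        · have hfS : ¬ (p (flip h) ∈ S ∨ p (flip h) ∉ Y) := fun hf => hi2 (by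
            rw [hO2, mem_image]
            exact ⟨h, by simpa [mem_between, hhT] using hf, by simp [hi]⟩)
          push Not at hfS
          right
          by_cases hfT : p (flip h) ∈ T
          · exact .inl ⟨⟨hhT, hi⟩, hfT⟩
          · right
            have hfC : p (flip h) ∈ C := by simp [hCdef, hfS, hfT]
            refine ⟨hhT, ?_⟩
            rw [hK, mem_filter]
            exact ⟨hfC, (hadj h _ _ hh hfS.2 hi (labC _ hfC)).symm⟩
        · left
          have hhC : p h ∈ C := by simp [hCdef, hh, hhS, hhT]
          rw [labC h hhC] at hi
          rw [hK, mem_filter]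
          exact ⟨hhC, Option.some.inj hi⟩
      · rintro (hh | ⟨⟨hh, hi⟩, -⟩ | ⟨hh, hf⟩)
        · rw [hK, mem_filter] at hh
          exact ⟨hCY hh.1, by rw [labC h hh.1, hh.2]⟩
        · exact ⟨hT hh, hi⟩
        · rw [hK, mem_filter] at hf
          obtain ⟨j, hj⟩ := Option.ne_none_iff_exists'.1 (memTa _ hh)
          refine ⟨hT hh, ?_⟩
          rw [hj, hadj h j _ (hT hh) (hCY hf.1) hj (labC _ hf.1), hf.2]
    have hTC : ∀ y ∈ T, y ∉ K := by
      intro y hy hyK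
      have := (mem_filter.1 hyK).1
      simp [hCdef, hy] at this
    rw [e1, e2, card_union_of_disjoint, card_union_of_disjoint, degsum K hKY] at hi
    · have hn : #(between p T K) = nb p K T := nb_comm p T K
      rw [hn] at hi
      obtain ⟨r, hr⟩ := hBeven
      obtain ⟨s, hs⟩ := hi
      rw [Nat.odd_iff]
      have : 2 * ℓ * #K = 2 * (ℓ * #K) := by ring
      omega
    · rw [Finset.disjoint_left]
      intro h h1 h2
      simp only [hB, mem_filter, mem_univ, true_and] at h1
      exact hTC _ h1.2 (by simpa using ((mem_between p).1 h2).2)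
    · rw [Finset.disjoint_left]
      intro h h1 h2
      simp only [mem_filter, mem_univ, true_and] at h1
      simp only [hB, mem_union, mem_filter, mem_univ, true_and, mem_between, mem_coe] at h2
      rcases h2 with h2 | h2
      · exact hTC _ h2.1.1 h1
      · exact hTC _ h2.1 h1
  have h3 := card_le_card hsub
  have h4 := card_union_le (O1 ∪ O2)
    ({i | Odd (ℓ * #(C.filter (lab · = i)) + nb p (C.filter (lab · = i)) T)} : Finset ι)
  have h5 := card_union_le O1 O2
  rw [hnone1, hnone2] at hcount
  have : 2 * ℓ * #S = ℓ * #S + ℓ * #S := by ring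
  omega

end Factor

/-! ### Walks and alternating segments -/

section Walk

variable {α β : Type*}

/-- `Walk p x es y`: the edges in the list `es` can be traversed, in this order, from `x` to `y`. -/
inductive Walk (p : β × Bool → α) : α → List β → α → Prop
  | nil (x : α) : Walk p x [] x
  | cons (h : β × Bool) {es : List β} {z : α} (w : Walk p (p (flip h)) es z) :
      Walk p (p h) (h.1 :: es) z

variable {p : β × Bool → α}

lemma Walk.append {x y z : α} {es fs : List β} (h : Walk p x es y) (h' : Walk p y fs z) :
    Walk p x (es ++ fs) z := by
  induction h with
  | nil => exact h'
  | cons h w ih => exact .cons h (ih h')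

lemma Walk.single (h : β × Bool) : Walk p (p h) [h.1] (p (flip h)) := .cons h (.nil _)

lemma Walk.reverse {x y : α} {es : List β} (h : Walk p x es y) : Walk p y es.reverse x := by
  induction h with
  | nil => exact .nil _
  | cons h w ih =>
    rw [List.reverse_cons]
    exact ih.append (by simpa using Walk.single (p := p) (flip h))

/-- Replacing each edge of a walk by a walk of odd length with the same ends gives a walk whose
length has the same parity. -/
lemma Walk.subst {γ : Type*} {q : γ × Bool → α} {L : γ → List β}
    (hL : ∀ j, Walk p (q (j, false)) (L j) (q (j, true))) (hodd : ∀ j, Odd (L j).length) {x y : α}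
    {js : List γ} (h : Walk q x js y) :
    ∃ es, Walk p x es y ∧ (Odd es.length ↔ Odd js.length) ∧
      (es : Multiset β) = (js : Multiset γ).bind fun j => (L j : Multiset β) := by
  induction h with
  | nil x => exact ⟨[], .nil x, Iff.rfl, rfl⟩
  | @cons h es' z w ih =>
    obtain ⟨es, hes, hpar, heq⟩ := ih
    have key (l : List β) (hl : l.length = (L h.1).length) :
        Odd (l ++ es).length ↔ Odd (es'.length + 1) := by
      rw [List.length_append, hl, Nat.odd_add, Nat.odd_add_one, ← hpar, Nat.not_odd_iff_even]
      simp [hodd h.1]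
    rw [← Multiset.cons_coe, Multiset.cons_bind, ← heq, List.length_cons]
    obtain ⟨j, _ | _⟩ := h
    · exact ⟨L j ++ es, (hL j).append hes, key _ rfl, by simp⟩
    · refine ⟨(L j).reverse ++ es, (hL j).reverse.append hes, key _ (by simp), ?_⟩
      rw [← Multiset.coe_add, Multiset.coe_reverse]

/-- The walk from `x` to `z` along `es` passes through `v`. -/
def Visits (p : β × Bool → α) (x : α) (es : List β) (z v : α) : Prop :=
  ∃ es₁ es₂, es = es₁ ++ es₂ ∧ Walk p x es₁ v ∧ Walk p v es₂ z

lemma Walk.visits_of_mem {x z : α} {es : List β} (hw : Walk p x es z) (h : β × Bool)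
    (hh : h.1 ∈ es) : Visits p x es z (p h) := by
  induction hw with
  | nil => simp at hh
  | @cons h₀ es z w ih =>
    rcases List.mem_cons.1 hh with he | he
    · have : h = h₀ ∨ h = flip h₀ := by
        obtain ⟨e, i⟩ := h
        obtain ⟨e₀, i₀⟩ := h₀
        cases i <;> cases i₀ <;> simp_all [flip]
      rcases this with rfl | rfl
      · exact ⟨[], _, rfl, .nil _, .cons _ w⟩
      · exact ⟨[h₀.1], es, rfl, .single _, w⟩
    · obtain ⟨e1, e2, rfl, w1, w2⟩ := ih he
      exact ⟨h₀.1 :: e1, e2, rfl, .cons _ w1, w2⟩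

lemma Walk.visits_left {x z : α} {es : List β} (hw : Walk p x es z) : Visits p x es z x :=
  ⟨[], es, rfl, .nil _, hw⟩

/-- Inserting a closed walk into a closed walk with which it shares a vertex. -/
lemma Visits.insert {b x v : α} {es fs : List β} (h : Visits p b es b v)
    (h' : Visits p x fs x v) :
    ∃ gs, Walk p b gs b ∧ (gs : Multiset β) = (es : Multiset β) + (fs : Multiset β) := by
  obtain ⟨e1, e2, rfl, w1, w2⟩ := h
  obtain ⟨f1, f2, rfl, v1, v2⟩ := h'
  refine ⟨e1 ++ (f2 ++ f1) ++ e2, (w1.append (v2.append v1)).append w2, ?_⟩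
  simp only [← Multiset.coe_add]
  abel

end Walk

section Segment

variable {α β : Type*}

/-- A walk together with its two ends and a colour at each end. -/
structure Segment (α β : Type*) where
  /-- The edges of the segment. -/
  edges : List β
  /-- The first vertex. -/
  src : α
  /-- The colour at the first vertex. -/
  srcColor : Bool
  /-- The last vertex. -/
  tgt : α
  /-- The colour at the last vertex. -/
  tgtColor : Bool

namespace Segment

/-- The edges of `t` form a walk from the first to the last vertex of `t`, and the colours at the
two ends could come from edges that are coloured alternately along this walk. -/
structure Valid (p : β × Bool → α) (t : Segment α β) : Prop where
  walk : Walk p t.src t.edges t.tgt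
  odd_iff : Odd t.edges.length ↔ t.srcColor = t.tgtColor

/-- The coloured ends of a segment. -/
def ends (t : Segment α β) : Multiset (α × Bool) := {(t.src, t.srcColor), (t.tgt, t.tgtColor)}

/-- The same segment, traversed backwards. -/
def symm (t : Segment α β) : Segment α β := ⟨t.edges.reverse, t.tgt, t.tgtColor, t.src, t.srcColor⟩

lemma ends_symm (t : Segment α β) : t.symm.ends = t.ends := Multiset.pair_comm _ _

lemma Valid.symm {p : β × Bool → α} {t : Segment α β} (ht : t.Valid p) : t.symm.Valid p :=
  ⟨ht.walk.reverse, by simp only [Segment.symm, List.length_reverse, ht.odd_iff, eq_comm]⟩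

lemma edges_symm (t : Segment α β) : (t.symm.edges : Multiset β) = t.edges :=
  Multiset.coe_reverse _

lemma mem_ends {t : Segment α β} {a : α × Bool} :
    a ∈ t.ends ↔ a = (t.src, t.srcColor) ∨ a = (t.tgt, t.tgtColor) := by
  simp [ends]

/-- A segment that has `a` among its ends can be traversed so that it begins at `a`. -/
lemma Valid.exists_src {p : β × Bool → α} {t : Segment α β} (ht : t.Valid p) {a : α × Bool}
    (ha : a ∈ t.ends) : ∃ t' : Segment α β, t'.Valid p ∧ t'.ends = t.ends ∧
      (t'.edges : Multiset β) = t.edges ∧ (t'.src, t'.srcColor) = a := by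
  rcases mem_ends.1 ha with rfl | rfl
  · exact ⟨t, ht, rfl, rfl, rfl⟩
  · exact ⟨t.symm, ht.symm, t.ends_symm, t.edges_symm, rfl⟩

/-- Joining the last vertex of a segment to the first vertex of another one, where they have
different colours, gives a valid segment. -/
lemma Valid.join {p : β × Bool → α} {t u : Segment α β} (ht : t.Valid p) (hu : u.Valid p)
    (h : t.tgt = u.src) (hc : t.tgtColor = !u.srcColor) :
    (⟨t.edges ++ u.edges, t.src, t.srcColor, u.tgt, u.tgtColor⟩ : Segment α β).Valid p := by
  refine ⟨ht.walk.append (h ▸ hu.walk), ?_⟩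
  simp only [List.length_append]
  have h1 := ht.odd_iff
  have h2 := hu.odd_iff
  rw [Nat.odd_add, ← Nat.not_odd_iff_even, h1, h2, hc]
  cases t.srcColor <;> cases u.srcColor <;> cases u.tgtColor <;> simp

lemma not_notMem {t : Segment α β} {Y : Finset α} {y : α} {c : Bool} (hy : y ∈ Y)
    (h : (y, c) ∈ t.ends) : ¬ (t.src ∉ Y ∧ t.tgt ∉ Y) := by
  rintro ⟨h1, h2⟩
  rcases mem_ends.1 h with h | h <;> simp only [Prod.mk.injEq] at h
  · exact h1 (h.1 ▸ hy)
  · exact h2 (h.1 ▸ hy)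

end Segment

lemma count_pair (y z : α) (c : Bool) :
    ({(y, c), (y, !c)} : Multiset (α × Bool)).count (z, true) =
      ({(y, c), (y, !c)} : Multiset (α × Bool)).count (z, false) := by
  by_cases hzy : z = y <;> cases c <;>
    simp [Multiset.insert_eq_cons, hzy]

lemma filter_pair {Y : Finset α} {y : α} (hy : y ∈ Y) (c : Bool) :
    ({(y, c), (y, !c)} : Multiset (α × Bool)).filter (·.1 ∉ Y) = 0 := by
  rw [Multiset.filter_eq_nil]
  intro a ha
  simp only [Multiset.insert_eq_cons, Multiset.mem_cons, Multiset.mem_singleton] at ha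
  rcases ha with rfl | rfl <;> simpa using hy

/-- If both colours occur equally often among the ends of a family of segments at each vertex of
`Y`, then these ends can be joined in pairs of different colours until no ends at `Y` are left. This
gives segments with ends outside `Y` and closed walks of even length. Segments that had no end at
`Y` to begin with are kept, and `n` only bounds the number of segments for the induction. -/
lemma exists_join {p : β × Bool → α} (Y : Finset α) (n : ℕ) (L : Multiset (Segment α β))
    (hn : L.card ≤ n) (hL : ∀ t ∈ L, t.Valid p)
    (hbal : ∀ y ∈ Y, (L.bind Segment.ends).count (y, true) =
      (L.bind Segment.ends).count (y, false)) :
    ∃ (L' : Multiset (Segment α β)) (D : Multiset (List β)),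
      (∀ t ∈ L', t.Valid p ∧ t.src ∉ Y ∧ t.tgt ∉ Y) ∧
      (∀ d ∈ D, Even d.length ∧ ∃ x, Walk p x d x) ∧
      (∀ t ∈ L, t.src ∉ Y → t.tgt ∉ Y → t ∈ L') ∧
      (L'.bind Segment.ends = (L.bind Segment.ends).filter (·.1 ∉ Y)) ∧
      (L'.bind (fun t => (t.edges : Multiset β)) + D.bind (fun d => (d : Multiset β)) =
        L.bind (fun t => (t.edges : Multiset β))) := by
  induction n generalizing L with
  | zero =>
    obtain rfl : L = 0 := Multiset.card_eq_zero.1 (by omega)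
    exact ⟨0, 0, by simp, by simp, by simp, by simp, by simp⟩
  | succ n ih =>
    by_cases hex : ∃ y ∈ Y, ∃ c, (y, c) ∈ L.bind Segment.ends
    swap
    · push Not at hex
      have hend : ∀ t ∈ L, ∀ a ∈ t.ends, a.1 ∉ Y := fun t ht a ha hY =>
        hex a.1 hY a.2 (Multiset.mem_bind.2 ⟨t, ht, ha⟩)
      refine ⟨L, 0, fun t ht => ⟨hL t ht, hend t ht _ (Segment.mem_ends.2 (.inl rfl)),
        hend t ht _ (Segment.mem_ends.2 (.inr rfl))⟩, by simp, fun t ht _ _ => ht, ?_, by simp⟩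
      rw [Multiset.filter_eq_self.2]
      intro a ha
      obtain ⟨t, ht, hat⟩ := Multiset.mem_bind.1 ha
      exact hend t ht a hat
    obtain ⟨y, hy, c, hc⟩ := hex
    have hc' : (y, !c) ∈ L.bind Segment.ends := by
      have := hbal y hy
      rw [← Multiset.count_pos] at hc ⊢
      cases c <;> simp <;> omega
    obtain ⟨t, ht, hat⟩ := Multiset.mem_bind.1 hc
    obtain ⟨L₁, rfl⟩ := Multiset.exists_cons_of_mem ht
    obtain ⟨t', ht', hends, hedges, hsrc⟩ := (hL t ht).exists_src hat
    simp only [Prod.mk.injEq] at hsrc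
    have hinY := Segment.not_notMem hy hat
    by_cases htgt : (t'.tgt, t'.tgtColor) = (y, !c)
    · -- the two ends belong to the same segment, which is a closed walk of even length
      simp only [Prod.mk.injEq] at htgt
      have hte : t.ends = {(y, c), (y, !c)} := by
        rw [← hends, Segment.ends, hsrc.1, hsrc.2, htgt.1, htgt.2]
      obtain ⟨L', D, h1, h2, h3, h4, h5⟩ := ih L₁ (by simp at hn; omega)
        (fun s hs => hL s (Multiset.mem_cons_of_mem hs)) (by
          intro z hz
          have := hbal z hz
          rw [Multiset.cons_bind, Multiset.count_add, Multiset.count_add, hte] at this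
          have e := count_pair y z c
          omega)
      refine ⟨L', t'.edges ::ₘ D, h1, ?_, ?_, ?_, ?_⟩
      · intro d hd
        rcases Multiset.mem_cons.1 hd with rfl | hd
        · refine ⟨?_, y, ?_⟩
          · rw [← Nat.not_odd_iff_even, ht'.odd_iff, hsrc.2, htgt.2]
            cases c <;> simp
          · have := ht'.walk
            rwa [hsrc.1, htgt.1] at this
        · exact h2 d hd
      · intro s hs hs1 hs2
        rcases Multiset.mem_cons.1 hs with rfl | hs
        · exact absurd ⟨hs1, hs2⟩ hinY
        · exact h3 s hs hs1 hs2
      · rw [h4, Multiset.cons_bind, Multiset.filter_add, hte]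
        rw [filter_pair hy, zero_add]
      · rw [Multiset.cons_bind, Multiset.cons_bind, ← h5, hedges]
        abel
    · -- the two ends belong to different segments, which are joined
      have hmem : (y, !c) ∈ L₁.bind Segment.ends := by
        rw [Multiset.cons_bind, Multiset.mem_add, ← hends] at hc'
        rcases hc' with h | h
        · rcases Segment.mem_ends.1 h with h | h
          · rw [hsrc.2] at h
            have := congrArg Prod.snd h
            cases c <;> simp at this
          · exact absurd h.symm htgt
        · exact h
      obtain ⟨u, hu, hau⟩ := Multiset.mem_bind.1 hmem
      obtain ⟨L₂, rfl⟩ := Multiset.exists_cons_of_mem hu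
      have huv := hL u (Multiset.mem_cons_of_mem hu)
      obtain ⟨u', hu', hends', hedges', hsrc'⟩ := huv.exists_src hau
      simp only [Prod.mk.injEq] at hsrc'
      have hinY' := Segment.not_notMem hy hau
      have hj := ht'.symm.join hu' (by rw [Segment.symm, hsrc.1, hsrc'.1])
        (by rw [Segment.symm, hsrc.2, hsrc'.2, Bool.not_not])
      set w : Segment α β :=
        ⟨t'.symm.edges ++ u'.edges, t'.symm.src, t'.symm.srcColor, u'.tgt, u'.tgtColor⟩ with hw
      have hwends : t.ends + u.ends = {(y, c), (y, !c)} + w.ends := by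
        rw [← hends, ← hends', Segment.ends, Segment.ends, Segment.ends, hsrc.1, hsrc.2, hsrc'.1,
          hsrc'.2]
        simp only [hw, Segment.symm, Multiset.insert_eq_cons, ← Multiset.singleton_add]
        abel
      have hsum : (t ::ₘ u ::ₘ L₂).bind Segment.ends =
          {(y, c), (y, !c)} + (w ::ₘ L₂).bind Segment.ends := by
        simp only [Multiset.cons_bind]
        rw [← add_assoc, hwends, add_assoc]
      obtain ⟨L', D, h1, h2, h3, h4, h5⟩ := ih (w ::ₘ L₂) (by simp at hn ⊢; omega)
        (by
          intro s hs
          rcases Multiset.mem_cons.1 hs with rfl | hs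
          · exact hj
          · exact hL s (Multiset.mem_cons_of_mem (Multiset.mem_cons_of_mem hs)))
        (by
          intro z hz
          have := hbal z hz
          rw [hsum, Multiset.count_add, Multiset.count_add] at this
          have e := count_pair y z c
          omega)
      refine ⟨L', D, h1, h2, ?_, ?_, ?_⟩
      · intro s hs hs1 hs2
        rcases Multiset.mem_cons.1 hs with rfl | hs
        · exact absurd ⟨hs1, hs2⟩ hinY
        rcases Multiset.mem_cons.1 hs with rfl | hs
        · exact absurd ⟨hs1, hs2⟩ hinY'
        · exact h3 s (Multiset.mem_cons_of_mem hs) hs1 hs2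
      · rw [h4, hsum, Multiset.filter_add]
        rw [filter_pair hy, zero_add]
      · rw [h5]
        simp only [Multiset.cons_bind]
        rw [← hedges, ← hedges', ← add_assoc]
        simp only [hw, ← Multiset.coe_add, Segment.edges_symm]

end Segment

/-! ### Rooted decompositions -/

section Decomposition

variable {α β γ : Type*} [Fintype β]

lemma bind_pair (f : β × Bool → γ) :
    (univ : Finset β).val.bind (fun e => ({f (e, false), f (e, true)} : Multiset γ)) =
      (univ : Finset (β × Bool)).val.map f := by
  have h1 : (univ : Finset (β × Bool)).val.map f = ∑ h, {f h} := by
    rw [Finset.sum, ← Multiset.sum_map_singleton ((univ : Finset (β × Bool)).val.map f),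
      Multiset.map_map]
    rfl
  have h2 : (univ : Finset β).val.bind (fun e => ({f (e, false), f (e, true)} : Multiset γ)) =
      ∑ e, ({f (e, true)} + {f (e, false)}) := by
    rw [Multiset.bind, Multiset.join, Finset.sum]
    congr 1
    refine Multiset.map_congr rfl fun e _ => ?_
    rw [Multiset.pair_comm, Multiset.insert_eq_cons, Multiset.singleton_add]
  rw [h1, h2, Fintype.sum_prod_type]
  exact sum_congr rfl fun e _ => by rw [Fintype.sum_bool]

lemma degree_eq_count (p : β × Bool → α) (v : α) :
    degree p v = ((univ : Finset (β × Bool)).val.map p).count v := by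
  rw [Multiset.count_map, degree, card_def, filter_val]
  congr 2; ext h; exact eq_comm

lemma cut_le_degree (p : β × Bool → α) (v : α) : cut p {v} ≤ degree p v :=
  card_le_card fun h => by simp +contextual [mem_between]

lemma cut_sdiff {p : β × Bool → α} {V H : Finset α} (hp : ∀ h, p h ∈ V) :
    cut p (V \ H : Finset α) = cut p H := by
  unfold cut
  rw [nb_comm]
  unfold nb; congr 1; ext h; simp [mem_between, hp]

/-- Splitting a set into two parts without edges between them splits its edge cut. -/
lemma cut_add_cut {p : β × Bool → α} {K H : Finset α} (hK : K ⊆ H)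
    (h0 : nb p K (H \ K : Finset α) = 0) :
    cut p K + cut p (H \ K : Finset α) = cut p H := by
  have hd : Disjoint (K : Set α) (H \ K : Finset α) := by
    exact_mod_cast disjoint_sdiff
  have hu : (H : Set α) = (K : Set α) ∪ ((H \ K : Finset α) : Set α) := by
    rw [← coe_union, union_sdiff_of_subset hK]
  have e1 : (K : Set α)ᶜ = ((H \ K : Finset α) : Set α) ∪ (H : Set α)ᶜ := by
    ext x; have := @hK x; simp; tauto
  have e2 : ((H \ K : Finset α) : Set α)ᶜ = (K : Set α) ∪ (H : Set α)ᶜ := by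
    ext x; have := @hK x; simp; tauto
  have d1 : Disjoint ((H \ K : Finset α) : Set α) (H : Set α)ᶜ := by
    rw [Set.disjoint_left]; intro x; simp; tauto
  have d2 : Disjoint (K : Set α) (H : Set α)ᶜ := by
    rw [Set.disjoint_left]; intro x; have := @hK x; simp; tauto
  unfold cut
  conv_rhs => rw [hu, nb_union_left p hd, ← hu]
  rw [e1, e2, nb_union_right p d1, nb_union_right p d2, h0, nb_comm p _ K, h0]
  omega

/-- The closed walks in `C` begin and end at `b` and have odd length, those in `D` have even length,
and together they use every edge exactly once. -/
structure IsRootedDecomposition (p : β × Bool → α) (b : α) (C D : Multiset (List β)) : Prop where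
  odd : ∀ c ∈ C, Odd c.length ∧ Walk p b c b
  even : ∀ d ∈ D, Even d.length ∧ ∃ x, Walk p x d x
  bind_eq : (C + D).bind (fun c => (c : Multiset β)) = (univ : Finset β).val

/-- For a minimum odd cut around `H`, all edges can be joined to walks `E j` of odd length between
vertices of `H` and closed walks `D` of even length. The graph `q` on `H` whose edges are the walks
`E j` is again `2ℓ`-regular, and contains the edges inside `H`. -/
lemma exists_segments {p : β × Bool → α} {V H : Finset α} {ℓ : ℕ} (hℓ : 0 < ℓ)
    (hp : ∀ h, p h ∈ V) (hreg : ∀ v ∈ V, degree p v = 2 * ℓ)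
    (hconn : ∀ K ⊆ V, K.Nonempty → K ≠ V → 0 < cut p K)
    (hV : Odd #V) (hHV : H ⊆ V) (hH : Odd #H)
    (hmin : ∀ K ⊆ V, Odd #K → K ≠ V → cut p H ≤ cut p K) (hcutH : cut p H ≤ 2 * ℓ) :
    ∃ (m : ℕ) (q : Fin m × Bool → α) (E : Fin m → List β) (D : Multiset (List β)),
      (∀ j, Walk p (q (j, false)) (E j) (q (j, true)) ∧ Odd (E j).length) ∧
      (∀ d ∈ D, Even d.length ∧ ∃ x, Walk p x d x) ∧
      (∀ h, p h ∈ H → p (flip h) ∈ H → ∃ h', q h' = p h ∧ q (flip h') = p (flip h)) ∧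
      (∀ h, q h ∈ H) ∧ (∀ v ∈ H, degree q v = 2 * ℓ) ∧
      (univ : Finset (Fin m)).val.bind (fun j => (E j : Multiset β)) +
        D.bind (fun d => (d : Multiset β)) = (univ : Finset β).val := by
  have hHne : H.Nonempty := card_pos.1 hH.pos
  have hYne : ∀ K ⊆ V \ H, K ≠ V := by
    rintro K hK rfl
    obtain ⟨x, hx⟩ := hHne
    have := hK (hHV hx)
    simp [hx] at this
  obtain ⟨c, hcY, hc⟩ := exists_factor (p := p) (Y := V \ H) hℓ
    (fun y hy => hreg y (sdiff_subset hy))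
    (by rw [card_sdiff_of_subset hHV]; exact Nat.Odd.sub_odd hV hH)
    (by rw [cut_sdiff hp]; exact hcutH)
    (fun K hK hne => hconn K (hK.trans sdiff_subset) hne (hYne K hK))
    (fun K hK ho => by
      rw [cut_sdiff hp]; exact hmin K (hK.trans sdiff_subset) ho (hYne K hK))
  set Y := V \ H with hYdef
  let s : β → Segment α β := fun e => ⟨[e], p (e, false), c e, p (e, true), c e⟩
  set L : Multiset (Segment α β) := (univ : Finset β).val.map s with hLdef
  have hLends : L.bind Segment.ends =
      (univ : Finset (β × Bool)).val.map (fun h => (p h, c h.1)) := by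
    rw [hLdef, Multiset.bind_map, ← bind_pair]
    rfl
  have hcount (y : α) (i : Bool) : (L.bind Segment.ends).count (y, i) =
      #{h | p h = y ∧ c h.1 = i} := by
    rw [hLends, Multiset.count_map, card_def, filter_val]
    congr 2; ext h; simp [eq_comm]
  obtain ⟨L', D, hL', hD, hkeep, hends, hedges⟩ := exists_join (p := p) Y L.card L le_rfl
    (by
      intro t ht
      obtain ⟨e, -, rfl⟩ := Multiset.mem_map.1 ht
      exact ⟨Walk.single (p := p) (e, false), by simp [s]⟩)
    (by
      intro y hy
      have hd := hreg y (sdiff_subset hy)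
      have hs := card_filter_add_card_filter_not (s := ({h | p h = y} : Finset (β × Bool)))
        (fun h => c h.1 = true)
      simp only [filter_filter, Bool.not_eq_true] at hs
      rw [hcount, hcount]
      have := hc y hy
      unfold degree at hd
      omega)
  obtain ⟨l, rfl⟩ : ∃ l : List (Segment α β), (l : Multiset _) = L' := ⟨_, L'.coe_toList⟩
  let q : Fin l.length × Bool → α := fun h => if h.2 then (l.get h.1).tgt else (l.get h.1).src
  have hl : (univ : Finset (Fin l.length)).val.map l.get = (l : Multiset _) := by
    rw [Fin.univ_val_map, List.ofFn_get]
  have hqends : (univ : Finset (Fin l.length × Bool)).val.map q =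
      ((univ : Finset (β × Bool)).val.map p).filter (· ∉ Y) := by
    have h1 := congrArg (Multiset.map Prod.fst) hends
    rw [hLends, ← hl, Multiset.bind_map, Multiset.map_bind] at h1
    rw [← bind_pair, Multiset.filter_map]
    rw [Multiset.filter_map, Multiset.map_map] at h1
    exact h1
  have hqH : ∀ h, q h ∈ H := by
    intro h
    have h1 : q h ∈ (univ : Finset (Fin l.length × Bool)).val.map q :=
      Multiset.mem_map_of_mem q (mem_univ h)
    rw [hqends, Multiset.mem_filter] at h1
    obtain ⟨h', -, hh'⟩ := Multiset.mem_map.1 h1.1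
    have h2 : q h ∈ V := hh' ▸ hp h'
    by_contra h3
    exact h1.2 (mem_sdiff.2 ⟨h2, h3⟩)
  -- edges of the factor lie inside `Y`, so both ends of a segment have the other colour
  have hcol : ∀ t ∈ (l : Multiset (Segment α β)), ∀ a ∈ t.ends, a.2 = false := by
    intro t ht a ha
    have h1 : a ∈ (l : Multiset (Segment α β)).bind Segment.ends :=
      Multiset.mem_bind.2 ⟨t, ht, ha⟩
    rw [hends, Multiset.mem_filter, hLends] at h1
    obtain ⟨h', -, rfl⟩ := Multiset.mem_map.1 h1.1
    by_contra h2
    exact h1.2 (hcY h' (by simpa using h2))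
  refine ⟨l.length, q, fun j => (l.get j).edges, D, ?_, hD, ?_, hqH, ?_, ?_⟩
  · intro j
    have hj : l.get j ∈ (l : Multiset (Segment α β)) := List.get_mem l j
    have hv := (hL' _ hj).1
    refine ⟨hv.walk, hv.odd_iff.2 ?_⟩
    have h1 := hcol _ hj _ (Segment.mem_ends.2 (.inl rfl))
    have h2 := hcol _ hj _ (Segment.mem_ends.2 (.inr rfl))
    simp only at h1 h2
    rw [h1, h2]
  · intro h h1 h2
    have hs : s h.1 ∈ (l : Multiset (Segment α β)) := by
      apply hkeep
      · exact Multiset.mem_map_of_mem s (mem_univ h.1)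
      · obtain ⟨e, _ | _⟩ := h <;> simp_all [s, flip]
      · obtain ⟨e, _ | _⟩ := h <;> simp_all [s, flip]
    obtain ⟨j, hj⟩ := List.mem_iff_get.1 (Multiset.mem_coe.1 hs)
    refine ⟨(j, h.2), ?_⟩
    obtain ⟨e, _ | _⟩ := h <;> simp only [q, flip, hj] <;> exact ⟨rfl, rfl⟩
  · intro v hv
    rw [degree_eq_count, hqends, Multiset.count_filter_of_pos (by simp [hYdef, hv]),
      ← degree_eq_count, hreg v (hHV hv)]
  · rw [← hl, Multiset.bind_map] at hedges
    rw [hedges, hLdef, Multiset.bind_map]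
    exact (Multiset.bind_singleton _ _).trans (Multiset.map_id' _)

/-- In a connected `2ℓ`-regular graph of odd order, the edges decompose into `ℓ` closed walks of odd
length through one common vertex and some closed walks of even length. The proof is by induction on
the number of vertices: the outside of a minimum odd cut is replaced by edges. -/
lemma exists_isRootedDecomposition {ℓ : ℕ} (hℓ : 0 < ℓ) (n : ℕ) :
    ∀ (m : ℕ) (p : Fin m × Bool → α) (V : Finset α), #V ≤ n → (∀ h, p h ∈ V) →
      (∀ v ∈ V, degree p v = 2 * ℓ) → Odd #V →
      (∀ K ⊆ V, K.Nonempty → K ≠ V → 0 < cut p K) →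
      ∃ b ∈ V, ∃ C D, IsRootedDecomposition p b C D ∧ C.card = ℓ := by
  induction n with
  | zero =>
    intro m p V hn _ _ hodd
    have := hodd.pos
    omega
  | succ n ih =>
    intro m p V hn hp hreg hodd hconn
    by_cases hV1 : #V = 1
    · obtain ⟨b, rfl⟩ := card_eq_one.1 hV1
      simp only [mem_singleton] at hp
      have hm : m = ℓ := by
        have := hreg b (mem_singleton_self b)
        simp only [degree, hp, filter_true, card_univ, Fintype.card_prod, Fintype.card_fin,
          Fintype.card_bool] at this
        omega
      refine ⟨b, mem_singleton_self b, (univ : Finset (Fin m)).val.map (fun e => [e]), 0,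
        ⟨?_, by simp, ?_⟩, by simp [hm]⟩
      · intro c hc
        obtain ⟨e, -, rfl⟩ := Multiset.mem_map.1 hc
        refine ⟨by simp, ?_⟩
        have := Walk.single (p := p) (e, false)
        rwa [hp, hp] at this
      · rw [add_zero, Multiset.bind_map]
        exact (Multiset.bind_singleton _ _).trans (Multiset.map_id' _)
    have hV3 : 1 < #V := by have := hodd.pos; omega
    have hsing : ∀ v ∈ V, ({v} : Finset α) ⊆ V ∧ Odd #({v} : Finset α) ∧ ({v} : Finset α) ≠ V :=
      fun v hv => ⟨by simpa using hv, by simp, fun h => by rw [← h] at hV3; simp at hV3⟩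
    obtain ⟨v, hv⟩ := card_pos.1 hodd.pos
    obtain ⟨H, hHF, hHmin⟩ := exists_min_image
      (V.powerset.filter fun K => Odd #K ∧ K ≠ V) (fun K => cut p K)
      ⟨{v}, by rw [mem_filter, mem_powerset]; exact hsing v hv⟩
    rw [mem_filter, mem_powerset] at hHF
    obtain ⟨hHV, hHodd, hHne⟩ := hHF
    have hmin : ∀ K ⊆ V, Odd #K → K ≠ V → cut p H ≤ cut p K := fun K h1 h2 h3 =>
      hHmin K (by rw [mem_filter, mem_powerset]; exact ⟨h1, h2, h3⟩)
    have hcutH : cut p H ≤ 2 * ℓ := by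
      have h1 := hmin _ (hsing v hv).1 (hsing v hv).2.1 (hsing v hv).2.2
      have h2 := cut_le_degree p v
      rw [coe_singleton] at h1
      rw [hreg v hv] at h2
      omega
    obtain ⟨m', q, E, D₀, hE, hD₀, hqedge, hqH, hqreg, hqbind⟩ :=
      exists_segments hℓ hp hreg hconn hodd hHV hHodd hmin hcutH
    have hHlt : #H < #V := card_lt_card (hHV.ssubset_of_ne hHne)
    have hqconn : ∀ K ⊆ H, K.Nonempty → K ≠ H → 0 < cut q K := by
      intro K hK hKne hKH
      -- without edges between the two parts, the odd part would have a smaller cut than `H`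
      have h1 : nb p K (H \ K : Finset α) ≠ 0 := by
        intro h0
        have hadd := cut_add_cut hK h0
        have hKV : K ≠ V := fun h => by
          have := card_le_card hK; rw [h] at this; omega
        have hsub : H \ K ⊆ V := sdiff_subset.trans hHV
        have hKV' : H \ K ≠ V := fun h => by
          have := card_le_card (sdiff_subset : H \ K ⊆ H); rw [h] at this; omega
        have hne' : (H \ K).Nonempty := by
          rw [sdiff_nonempty]; exact fun h => hKH (hK.antisymm h)
        have p1 := hconn K (hK.trans hHV) hKne hKV
        have p2 := hconn _ hsub hne' hKV'
        have hcard := card_sdiff_add_card_eq_card hK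
        rcases Nat.even_or_odd #K with hev | hod
        · have : Odd #(H \ K) := by
            rw [← hcard, Nat.odd_add] at hHodd
            exact hHodd.2 hev
          have := hmin _ hsub this hKV'
          omega
        · have := hmin _ (hK.trans hHV) hod hKV
          omega
      obtain ⟨h, hh⟩ := card_pos.1 (Nat.pos_of_ne_zero h1)
      simp only [mem_between, mem_coe, mem_sdiff] at hh
      obtain ⟨h', e1, e2⟩ := hqedge h (hK hh.1) hh.2.1
      refine card_pos.2 ⟨h', ?_⟩
      rw [mem_between, e1, e2]
      exact ⟨hh.1, hh.2.2⟩
    obtain ⟨b, hb, C', D', hdec, hcard⟩ := ih m' q H (by omega) hqH hqreg hHodd hqconn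
    have hC : ∀ c ∈ C', ∃ es : List (Fin m), (Odd es.length ∧ Walk p b es b) ∧
        (es : Multiset (Fin m)) =
          (c : Multiset (Fin m')).bind fun j => (E j : Multiset (Fin m)) := by
      intro c hc
      obtain ⟨es, h1, h2, h3⟩ := (hdec.odd c hc).2.subst (fun j => (hE j).1) (fun j => (hE j).2)
      exact ⟨es, ⟨h2.2 (hdec.odd c hc).1, h1⟩, h3⟩
    have hD : ∀ d ∈ D', ∃ es : List (Fin m), (Even es.length ∧ ∃ x, Walk p x es x) ∧
        (es : Multiset (Fin m)) =
          (d : Multiset (Fin m')).bind fun j => (E j : Multiset (Fin m)) := by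
      intro d hd
      obtain ⟨hev, x, hx⟩ := hdec.even d hd
      obtain ⟨es, h1, h2, h3⟩ := hx.subst (fun j => (hE j).1) (fun j => (hE j).2)
      refine ⟨es, ⟨?_, x, h1⟩, h3⟩
      rw [← Nat.not_odd_iff_even] at hev ⊢
      exact fun h => hev (h2.1 h)
    choose! f hf1 hf2 using hC
    choose! g hg1 hg2 using hD
    refine ⟨b, hHV hb, C'.map f, D'.map g + D₀, ⟨?_, ?_, ?_⟩, by simpa using hcard⟩
    · intro c hc
      obtain ⟨c', hc', rfl⟩ := Multiset.mem_map.1 hc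
      exact hf1 c' hc'
    · intro d hd
      rcases Multiset.mem_add.1 hd with hd | hd
      · obtain ⟨d', hd', rfl⟩ := Multiset.mem_map.1 hd
        exact hg1 d' hd'
      · exact hD₀ d hd
    · rw [← hqbind, ← hdec.bind_eq, Multiset.bind_assoc, ← add_assoc, Multiset.add_bind,
        Multiset.add_bind, Multiset.add_bind, Multiset.bind_map, Multiset.bind_map,
        Multiset.bind_congr hf2, Multiset.bind_congr hg2]

/-- By connectedness, the closed walks of even length can be inserted into those through the
root. -/
lemma IsRootedDecomposition.absorb {p : β × Bool → α} {V : Finset α} {b : α} (hb : b ∈ V)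
    (hp : ∀ h, p h ∈ V) (hconn : ∀ K ⊆ V, K.Nonempty → K ≠ V → 0 < cut p K) (n : ℕ) :
    ∀ C D : Multiset (List β), D.card = n → C ≠ 0 → IsRootedDecomposition p b C D →
      ∃ C', IsRootedDecomposition p b C' 0 ∧ C'.card = C.card := by
  induction n with
  | zero =>
    intro C D hn _ hdec
    obtain rfl := Multiset.card_eq_zero.1 hn
    exact ⟨C, hdec, rfl⟩
  | succ n ih =>
    intro C D hn hC hdec
    by_cases hnil : [] ∈ D
    · obtain ⟨D, rfl⟩ := Multiset.exists_cons_of_mem hnil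
      refine ih C D (by simpa using hn) hC ⟨hdec.odd, fun d hd =>
        hdec.even d (Multiset.mem_cons_of_mem hd), ?_⟩
      rw [← hdec.bind_eq, Multiset.add_bind, Multiset.add_bind, Multiset.cons_bind]
      simp
    -- the vertices on the walks through the root
    set R : Finset α := V.filter (fun v => ∃ c ∈ C, Visits p b c b v) with hR
    have hbR : b ∈ R := by
      obtain ⟨c, hc⟩ := Multiset.exists_mem_of_ne_zero hC
      exact mem_filter.2 ⟨hb, c, hc, (hdec.odd c hc).2.visits_left⟩
    have hfind : ∃ d ∈ D, ∃ x v, Visits p x d x v ∧ v ∈ R := by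
      by_cases hRV : R = V
      · have hDne : D ≠ 0 := by rintro rfl; simp at hn
        obtain ⟨d, hd⟩ := Multiset.exists_mem_of_ne_zero hDne
        obtain ⟨-, x, hx⟩ := hdec.even d hd
        refine ⟨d, hd, x, x, hx.visits_left, ?_⟩
        rw [hRV]
        cases hx with
        | nil => exact absurd hd hnil
        | cons h w => exact hp h
      · obtain ⟨h, hh⟩ := card_pos.1 (hconn R (filter_subset _ _) ⟨b, hbR⟩ hRV)
        rw [mem_between] at hh
        have hmem : h.1 ∈ (C + D).bind (fun c => (c : Multiset β)) := by
          rw [hdec.bind_eq]; exact mem_univ h.1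
        obtain ⟨d, hd, hhd⟩ := Multiset.mem_bind.1 hmem
        rw [Multiset.mem_coe] at hhd
        rcases Multiset.mem_add.1 hd with hd | hd
        · refine absurd (mem_filter.2 ⟨hp _, d, hd, ?_⟩) hh.2
          exact (hdec.odd d hd).2.visits_of_mem (flip h) hhd
        · obtain ⟨-, x, hx⟩ := hdec.even d hd
          exact ⟨d, hd, x, p h, hx.visits_of_mem h hhd, hh.1⟩
    obtain ⟨d, hd, x, v, hdv, hvR⟩ := hfind
    obtain ⟨-, c, hc, hcv⟩ := mem_filter.1 hvR
    obtain ⟨gs, hgs, hgse⟩ := hcv.insert hdv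
    obtain ⟨C, rfl⟩ := Multiset.exists_cons_of_mem hc
    have hdev := (hdec.even d hd).1
    obtain ⟨D, rfl⟩ := Multiset.exists_cons_of_mem hd
    have hnew : IsRootedDecomposition p b (gs ::ₘ C) D := by
      refine ⟨?_, ?_, ?_⟩
      · intro c' hc'
        rcases Multiset.mem_cons.1 hc' with rfl | hc'
        · refine ⟨?_, hgs⟩
          have := congrArg Multiset.card hgse
          simp only [Multiset.coe_card, Multiset.card_add] at this
          rw [this]
          exact (hdec.odd c hc).1.add_even hdev
        · exact hdec.odd c' (Multiset.mem_cons_of_mem hc')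
      · exact fun d' hd' => hdec.even d' (Multiset.mem_cons_of_mem hd')
      · rw [← hdec.bind_eq, Multiset.add_bind, Multiset.add_bind, Multiset.cons_bind,
          Multiset.cons_bind, Multiset.cons_bind, hgse]
        abel
    obtain ⟨C', hC', hcard⟩ := ih (gs ::ₘ C) D (by simpa using hn) Multiset.cons_ne_zero hnew
    exact ⟨C', hC', by simpa using hcard⟩

end Decomposition

/-! ### From half-edges to graphs -/

section Transfer

variable {α β : Type*}

lemma Walk.isWalk {G : Graph α β} {m : ℕ} {f : Fin m → β} {p : Fin m × Bool → α}
    (hp : ∀ h, G.IsLink (f h.1) (p h) (p (flip h))) {x y : α} {es : List (Fin m)}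
    (hx : x ∈ V(G)) (hw : Walk p x es y) : G.IsWalk x (es.map f) y := by
  induction hw with
  | nil => exact .nil hx
  | cons h w ih => exact .cons (hp h) (ih (hp h).right_mem)

/-- A walk that leaves a set uses an edge that leaves it. -/
lemma exists_isLink_of_isWalk {G : Graph α β} {K : Set α} {x y : α} {es : List β}
    (hw : G.IsWalk x es y) (hx : x ∈ K) (hy : y ∉ K) :
    ∃ e u v, G.IsLink e u v ∧ u ∈ K ∧ v ∉ K := by
  induction hw with
  | nil => exact absurd hx hy
  | @cons x v z e es h w ih =>
    by_cases hv : v ∈ K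
    · exact ih hv hy
    · exact ⟨e, x, v, h, hx, hv⟩

/-- Loops count twice in both notions of degree. -/
lemma degree_eq_deg {G : Graph α β} {m : ℕ} {f : Fin m → β} {p : Fin m × Bool → α}
    (hf : Function.Injective f) (hfE : ∀ e ∈ E(G), ∃ j, f j = e)
    (hp : ∀ h, G.IsLink (f h.1) (p h) (p (flip h))) (x : α) : degree p x = G.deg x := by
  have hlink (j : Fin m) : G.IsLink (f j) (p (j, false)) (p (j, true)) := hp (j, false)
  have h1 : {e | G.IsNonloopAt e x} =
      f '' {j | (p (j, false) = x ∧ p (j, true) ≠ x) ∨ (p (j, false) ≠ x ∧ p (j, true) = x)} := by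
    ext e
    constructor
    · rintro ⟨y, hy, he⟩
      obtain ⟨j, rfl⟩ := hfE e he.edge_mem
      refine ⟨j, ?_, rfl⟩
      rcases (hlink j).eq_and_eq_or_eq_and_eq he with ⟨h, h'⟩ | ⟨h, h'⟩
      · exact .inl ⟨h, h' ▸ hy⟩
      · exact .inr ⟨h ▸ hy, h'⟩
    · rintro ⟨j, ⟨h, h'⟩ | ⟨h, h'⟩, rfl⟩
      · exact ⟨_, h', h ▸ hlink j⟩
      · exact ⟨_, h, h' ▸ (hlink j).symm⟩
  have h2 : {e | G.IsLoopAt e x} = f '' {j | p (j, false) = x ∧ p (j, true) = x} := by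
    ext e
    constructor
    · intro he
      have he' : G.IsLink e x x := he
      obtain ⟨j, rfl⟩ := hfE e he'.edge_mem
      refine ⟨j, ?_, rfl⟩
      rcases (hlink j).eq_and_eq_or_eq_and_eq he' with ⟨h, h'⟩ | ⟨h, h'⟩ <;> exact ⟨h, h'⟩
    · rintro ⟨j, ⟨h, h'⟩, rfl⟩
      have := hlink j
      rw [h, h'] at this
      exact this
  unfold Graph.deg
  rw [h1, h2, Set.ncard_image_of_injective _ hf, Set.ncard_image_of_injective _ hf,
    Set.ncard_eq_toFinset_card', Set.ncard_eq_toFinset_card', Set.toFinset_ofPred,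
    Set.toFinset_ofPred, degree, card_filter, card_filter, card_filter, Fintype.sum_prod_type,
    mul_sum, ← sum_add_distrib]
  refine sum_congr rfl fun j _ => ?_
  rw [Fintype.sum_bool]
  by_cases h3 : p (j, false) = x <;> by_cases h4 : p (j, true) = x <;> simp [h3, h4]

end Transfer

end HalfEdge

open HalfEdge in
theorem mainTheorem2 {α β : Type*} (G : Graph α β) (hV : V(G).Finite) (hE : E(G).Finite)
    (ℓ : ℕ) (hℓ : 0 < ℓ) (hconn : G.IsConnected) (hreg : G.IsRegular (2 * ℓ))
    (hodd : Odd V(G).ncard) :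
    ∃ b ∈ V(G), ∃ C : Fin ℓ → List β, G.IsCircuitDecomposition C ∧
      ∀ i, G.IsCircuitAt b (C i) ∧ Odd (C i).length := by
  classical
  have := hE.fintype
  obtain ⟨m, ⟨φ⟩⟩ : ∃ m, Nonempty (Fin m ≃ E(G)) := ⟨_, ⟨(Fintype.equivFin _).symm⟩⟩
  let f : Fin m → β := fun j => (φ j).1
  have hf : Function.Injective f := Subtype.val_injective.comp φ.injective
  have hfE : ∀ e ∈ E(G), ∃ j, f j = e := fun e he => ⟨φ.symm ⟨e, he⟩, by simp [f]⟩
  have hends : ∀ j, ∃ x y, G.IsLink (f j) x y := fun j =>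
    Graph.exists_isLink_of_mem_edgeSet (φ j).2
  choose s t hst using hends
  let p : Fin m × Bool → α := fun h => if h.2 then t h.1 else s h.1
  have hp : ∀ h, G.IsLink (f h.1) (p h) (p (flip h)) := by
    rintro ⟨j, _ | _⟩
    · exact hst j
    · exact (hst j).symm
  set W := hV.toFinset with hW
  have hWmem : ∀ v, v ∈ W ↔ v ∈ V(G) := fun v => hV.mem_toFinset
  have hpW : ∀ h, p h ∈ W := fun h => (hWmem _).2 (hp h).left_mem
  have hcut : ∀ K ⊆ W, K.Nonempty → K ≠ W → 0 < cut p K := by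
    intro K hK hne hKW
    obtain ⟨x, hx⟩ := hne
    obtain ⟨y, hyW, hyK⟩ := Finset.exists_of_ssubset (hK.ssubset_of_ne hKW)
    obtain ⟨es, hw⟩ := hconn.2 x ((hWmem x).1 (hK hx)) y ((hWmem y).1 hyW)
    obtain ⟨e, u, v, he, hu, hv⟩ := exists_isLink_of_isWalk (K := K) hw hx hyK
    obtain ⟨j, rfl⟩ := hfE e he.edge_mem
    rcases (hst j).eq_and_eq_or_eq_and_eq he with ⟨rfl, rfl⟩ | ⟨rfl, rfl⟩
    · exact Finset.card_pos.2 ⟨(j, false), (mem_between p).2 ⟨hu, hv⟩⟩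
    · exact Finset.card_pos.2 ⟨(j, true), (mem_between p).2 ⟨hu, hv⟩⟩
  obtain ⟨b, hb, C, D, hdec, hcard⟩ := exists_isRootedDecomposition hℓ W.card m p W le_rfl hpW
    (fun v hv => (degree_eq_deg hf hfE hp v).trans (hreg v ((hWmem v).1 hv)))
    (by rwa [hW, ← Set.ncard_eq_toFinset_card _ hV]) hcut
  have hC0 : C ≠ 0 := by
    rintro rfl
    rw [Multiset.card_zero] at hcard
    omega
  obtain ⟨C, hdec, hcard'⟩ := hdec.absorb hb hpW hcut _ C D rfl hC0
  rw [← hcard'] at hcard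
  obtain ⟨l, rfl⟩ : ∃ l : List (List (Fin m)), (l : Multiset _) = C := ⟨_, C.coe_toList⟩
  rw [Multiset.coe_card] at hcard
  subst hcard
  have hbV := (hWmem b).1 hb
  have hflat : ((l.flatMap id : List (Fin m)) : Multiset (Fin m)) = Finset.univ.val := by
    rw [← hdec.bind_eq, add_zero]
    exact (Multiset.coe_bind l id).symm
  have hnodup : (l.flatMap id).Nodup := by
    rw [← Multiset.coe_nodup, hflat]
    exact Finset.univ.nodup
  rw [List.nodup_flatMap] at hnodup
  have hcirc : ∀ i, G.IsCircuitAt b ((l.get i).map f) ∧ Odd ((l.get i).map f).length := by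
    intro i
    have hi : l.get i ∈ l := List.get_mem l i
    obtain ⟨ho, hw⟩ := hdec.odd _ (Multiset.mem_coe.2 hi)
    refine ⟨⟨hw.isWalk hp hbV, ?_, (hnodup.1 _ hi).map hf⟩, by simpa using ho⟩
    intro h
    rw [List.map_eq_nil_iff] at h
    rw [h] at ho
    simp at ho
  refine ⟨b, hbV, fun i => (l.get i).map f, ⟨fun i => ⟨b, (hcirc i).1⟩, ?_⟩, hcirc⟩
  intro e he
  obtain ⟨j, rfl⟩ := hfE e he
  have hj : j ∈ l.flatMap id := by
    rw [← Multiset.mem_coe, hflat]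
    exact Finset.mem_univ j
  obtain ⟨c, hc, hjc⟩ := List.mem_flatMap.1 hj
  obtain ⟨i, rfl⟩ := List.mem_iff_get.1 hc
  refine ⟨i, List.mem_map_of_mem hjc, fun i' hi' => ?_⟩
  simp only at hi'
  rw [List.mem_map_of_injective hf] at hi'
  by_contra hne
  have hpw := List.pairwise_iff_get.1 hnodup.2
  rcases lt_or_gt_of_ne hne with h | h
  · exact hpw _ _ h hi' hjc
  · exact hpw _ _ h hjc hi'
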